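/- Let $m\ge 1$ be an integer, let $S^{2m+1}\subset\mathbb{C}^{m+1}$ be the unit sphere with the induced Riemannian metric $g=\langle\cdot,\cdot\rangle$, its Levi-Civita connection $\nabla$ and its volume measure, and let $p,q\in\mathbb{R}$. On the total space of the tangent bundle $\pi\colon TS^{2m+1}\to S^{2m+1}$ consider the symmetric tensor $$h_{p,q}(A,B)=g(d\pi A,d\pi B)+\frac{1}{(1+|e|^2)^p}\bigl(\langle KA,KB\rangle+q\,\langle KA,e\rangle\langle KB,e\rangle\bigr),\qquad A,B\in T_e(TS^{2m+1}),$$ where $K$ is the connection map of $\nabla$. For a smooth vector field $\sigma$ on $S^{2m+1}$ let $d^v\sigma$ be the vertical part of $d\sigma$ and let $$E^v_{p,q}(\sigma)=\frac12\int_{S^{2m+1}}|d^v\sigma|^2=\frac12\int_{S^{2m+1}}\sum_i h_{p,q}\bigl(d^v\sigma(E_i),d^v\sigma(E_i)\bigr),$$ where $(E_i)$ is a local orthonormal frame. Call $\sigma$ a $(p,q)$-harmonic section of $TS^{2m+1}$ if $\frac{d}{dt}\big|_{t=0}E^v_{p,q}(\sigma_t)=0$ for every smooth variation $\sigma_t$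 of $\sigma=\sigma_0$ through vector fields, and call it non-trivial if it is not the zero vector field. Let $\xi(x)=ix$ be the Hopf vector field on $S^{2m+1}$ and let $f\colon S^{2m+1}\to\mathbb{R}$ be any smooth function. Then $\sigma=f\xi$ is a non-trivial $(p,q)$-harmonic section of $TS^{2m+1}$ if and only if $p>1$ and $f$ is constant, equal to $1/\sqrt{p-1}$ or to $-1/\sqrt{p-1}$. -/

import Mathlib

open MeasureTheory Module
open scoped Manifold ContDiff InnerProductSpace

noncomputable section

namespace HopfPQ

section Sphere

/-! The unit sphere `S` of a finite-dimensional real inner product space `E`. Its tangent space at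
`x` is the hyperplane `xᗮ` of `E`, with the induced metric; a vector field on `S` is
a map `σ : S → E` with `σ x ∈ xᗮ` for all `x`. -/

variable {E : Type*} [NormedAddCommGroup E] [InnerProductSpace ℝ E]

/-- The tangent space of the unit sphere at `x`, as a subspace of the ambient space. -/
abbrev tangentPlane (x : Metric.sphere (0 : E) 1) : Submodule ℝ E :=
  (Submodule.span ℝ {(x : E)})ᗮ

/-- The extension of a map on the unit sphere to `E \ {0}` that is constant on rays
(with the value `0` at the origin). -/
def radialExt (φ : Metric.sphere (0 : E) 1 → E) (y : E) : E :=
  open Classical in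
  if h : y = 0 then 0
  else φ ⟨‖y‖⁻¹ • y, by
    rw [mem_sphere_zero_iff_norm, norm_smul, norm_inv, norm_norm,
      inv_mul_cancel₀ (norm_ne_zero_iff.mpr h)]⟩

/-- The derivative at `x` of an `E`-valued map on the unit sphere, along `X ∈ xᗮ`. -/
def sphereDeriv (φ : Metric.sphere (0 : E) 1 → E) (x : Metric.sphere (0 : E) 1) (X : E) : E :=
  fderiv ℝ (radialExt φ) (x : E) X

/-- The connection map `K : T(TS) → TS` of the Levi-Civita connection of the sphere.
With `TS ⊆ E × E`, a tangent vector of `TS` at `(x, e)` is a pair `A = (A.1, A.2)` with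
`dπ(A) = A.1`, and `K A` is the orthogonal projection of `A.2` to `xᗮ`. -/
def connectionMap [FiniteDimensional ℝ E] (x : Metric.sphere (0 : E) 1) (A : E × E) : E :=
  (tangentPlane x).starProjection A.2

/-- The differential of a vector field `σ`, viewed as the map `x ↦ (x, σ x)` into
`TS ⊆ E × E`. -/
def sectionDiff (σ : Metric.sphere (0 : E) 1 → E) (x : Metric.sphere (0 : E) 1) (X : E) : E × E :=
  (X, sphereDeriv σ x X)

/-- The covariant derivative `∇_X σ = K (dσ(X))` for the Levi-Civita connection of the sphere:
the tangential part of the derivative of `σ` along `X`. -/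
def covDeriv [FiniteDimensional ℝ E] (σ : Metric.sphere (0 : E) 1 → E)
    (x : Metric.sphere (0 : E) 1) (X : E) : E :=
  connectionMap x (sectionDiff σ x X)

/-- The vertical part `dᵛσ(X)` of `dσ(X)`: the vector tangent to the fibre (that is, with
`dπ = 0`) with the same image under the connection map. -/
def vertDiff [FiniteDimensional ℝ E] (σ : Metric.sphere (0 : E) 1 → E)
    (x : Metric.sphere (0 : E) 1) (X : E) : E × E :=
  (0, covDeriv σ x X)

/-- The symmetric tensor `h_{p,q}` at the point `(x, e)` of `TS`:
`h(A, B) = g(dπ A, dπ B) + w(e)^p (⟨KA, KB⟩ + q ⟨KA, e⟩ ⟨KB, e⟩)` with `w(e) = 1 / (1 + |e|²)`. -/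
def pqMetric [FiniteDimensional ℝ E] (p q : ℝ) (x : Metric.sphere (0 : E) 1) (e : E)
    (A B : E × E) : ℝ :=
  ⟪A.1, B.1⟫_ℝ + (1 / (1 + ‖e‖ ^ 2)) ^ p *
    (⟪connectionMap x A, connectionMap x B⟫_ℝ +
      q * ⟪connectionMap x A, e⟫_ℝ * ⟪connectionMap x B, e⟫_ℝ)

/-- `|dᵛσ|²` at `x` with respect to `h_{p,q}`: the trace over an orthonormal basis of the
tangent space. -/
def vertEnergyDensity [FiniteDimensional ℝ E] (p q : ℝ) (σ : Metric.sphere (0 : E) 1 → E)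
    (x : Metric.sphere (0 : E) 1) : ℝ :=
  ∑ i, pqMetric p q x (σ x)
    (vertDiff σ x (stdOrthonormalBasis ℝ (tangentPlane x) i))
    (vertDiff σ x (stdOrthonormalBasis ℝ (tangentPlane x) i))

/-- The vertical `(p,q)`-energy `½ ∫ |dᵛσ|²`, with respect to the surface measure of the
unit sphere. -/
def vertEnergy [FiniteDimensional ℝ E] [MeasurableSpace E] [BorelSpace E] (p q : ℝ)
    (σ : Metric.sphere (0 : E) 1 → E) : ℝ :=
  1 / 2 * ∫ x, vertEnergyDensity p q σ x ∂(volume : Measure E).toSphere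

/-- Smooth vector fields on the unit sphere `S ⊆ E`, `dim S = n`. -/
structure IsSmoothSection (n : ℕ) [Fact (finrank ℝ E = n + 1)]
    (σ : Metric.sphere (0 : E) 1 → E) : Prop where
  smooth : ContMDiff (𝓡 n) 𝓘(ℝ, E) ∞ σ
  tangent : ∀ x, σ x ∈ tangentPlane x

/-- Smooth one-parameter variations `(t, x) ↦ σ_t(x)` of `σ` through vector fields. -/
structure IsSmoothVariation (n : ℕ) [Fact (finrank ℝ E = n + 1)]
    (σ : Metric.sphere (0 : E) 1 → E) (τ : ℝ → Metric.sphere (0 : E) 1 → E) : Prop where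
  smooth : ContMDiff (𝓘(ℝ, ℝ).prod (𝓡 n)) 𝓘(ℝ, E) ∞
    (fun z : ℝ × Metric.sphere (0 : E) 1 => τ z.1 z.2)
  tangent : ∀ t x, τ t x ∈ tangentPlane x
  init : τ 0 = σ

/-- `σ` is a `(p,q)`-harmonic section of `TS`: a smooth vector field at which the vertical
`(p,q)`-energy is stationary for all smooth variations through vector fields. -/
def IsPQHarmonic [FiniteDimensional ℝ E] [MeasurableSpace E] [BorelSpace E]
    (n : ℕ) [Fact (finrank ℝ E = n + 1)] (p q : ℝ)
    (σ : Metric.sphere (0 : E) 1 → E) : Prop :=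
  IsSmoothSection n σ ∧
    ∀ τ : ℝ → Metric.sphere (0 : E) 1 → E, IsSmoothVariation n σ τ →
      HasDerivAt (fun t => vertEnergy p q (τ t)) 0 0

end Sphere

section Hopf

/-- The complex vector space `ℂ^{m+1}` is a real Euclidean space of dimension `2m + 2`. -/
instance finrank_fact (m : ℕ) :
    Fact (finrank ℝ (EuclideanSpace ℂ (Fin (m + 1))) = (2 * m + 1) + 1) :=
  ⟨by rw [← finrank_mul_finrank ℝ ℂ, Complex.finrank_real_complex, finrank_euclideanSpace_fin]
      ring⟩

/-- The Hopf vector field `ξ(x) = i x` on the unit sphere of `ℂ^{m+1}`. -/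
def hopf (m : ℕ) (x : Metric.sphere (0 : EuclideanSpace ℂ (Fin (m + 1))) 1) :
    EuclideanSpace ℂ (Fin (m + 1)) :=
  Complex.I • (x : EuclideanSpace ℂ (Fin (m + 1)))

end Hopf

end HopfPQ

end

/-! Extend fields to `E \ {0}` constantly on rays, so that covariant derivatives become ordinary
ones, and let `J` be multiplication by `i`, `n = 2m + 1`, `w = 1 / (1 + f²)`. Stationarity of the
energy means that the first variation integral vanishes for every smooth tangent field `V`
(`isPQHarmonic_iff`). Two kinds of test field suffice.

If `V` is orthogonal to `ξ`, the `p`- and `q`-terms of the integrand drop out. Integration by parts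
leaves the integral of `2 w^(p+1) (1 + (1 - p) f²) df(JV)`
(`integral_firstVariation_of_orthogonal`). Choosing `V` so that `JV` is `1 + (1 - p) f²` times the
horizontal gradient of `f` makes the integrand nonnegative, so this product vanishes. Hence `f + (1
- p) f³ / 3` has zero derivative along the contact distribution `ξᗮ`. Any two points are joined by
three horizontal arcs (`eq_of_fderiv_horizontal_eq_zero`), so this cubic in `f` is constant; `f`
then has finitely many values on a connected sphere and is itself constant.

If `f = c`, the first variation is a positive multiple of `c (n - 1) (1 + c² - p c²) ∫ ⟪ξ, V⟫` for
every `V` (`integral_firstVariation_const`). Testing with `V = ξ` gives `c = 0` or `c² (p - 1) = 1`,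
and these conditions are also sufficient. -/

noncomputable section

namespace HopfPQ

/-! ### Extension of maps from the sphere, constant on rays. -/

section RayExtension

variable {E : Type*} [NormedAddCommGroup E] [InnerProductSpace ℝ E]
variable {F : Type*} [NormedAddCommGroup F]

/-- The extension of a vector-valued map on the unit sphere that is constant on rays. -/
def rayExt (φ : Metric.sphere (0 : E) 1 → F) (y : E) : F :=
  open Classical in
  if h : y = 0 then 0
  else φ ⟨‖y‖⁻¹ • y, by
    rw [mem_sphere_zero_iff_norm, norm_smul, norm_inv, norm_norm,
      inv_mul_cancel₀ (norm_ne_zero_iff.mpr h)]⟩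

theorem rayExt_coe (φ : Metric.sphere (0 : E) 1 → F) (x : Metric.sphere (0 : E) 1) :
    rayExt φ (x : E) = φ x := by
  have hx : ‖(x : E)‖ = 1 := by simp
  have h0 : (x : E) ≠ 0 := ne_zero_of_mem_unit_sphere x
  rw [rayExt, dif_neg h0]
  congr 1
  ext
  simp [hx]

theorem rayExt_smul (φ : Metric.sphere (0 : E) 1 → F) {r : ℝ} (hr : 0 < r) (y : E) :
    rayExt φ (r • y) = rayExt φ y := by
  by_cases hy : y = 0
  · simp [hy]
  · have h1 : r • y ≠ 0 := smul_ne_zero hr.ne' hy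
    rw [rayExt, rayExt, dif_neg h1, dif_neg hy]
    congr 2
    rw [norm_smul, Real.norm_of_nonneg hr.le, smul_smul]
    congr 1
    field_simp

variable [NormedSpace ℝ F]

open TopologicalSpace in
theorem contDiffAt_rayExt_family {n : ℕ} [Fact (finrank ℝ E = n + 1)]
    {τ : ℝ → Metric.sphere (0 : E) 1 → F}
    (hτ : ContMDiff (𝓘(ℝ, ℝ).prod (𝓡 n)) 𝓘(ℝ, F) ∞
      (fun z : ℝ × Metric.sphere (0 : E) 1 => τ z.1 z.2)) {z : ℝ × E} (hz : z.2 ≠ 0) :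
    ContDiffAt ℝ ∞ (fun z : ℝ × E => rayExt (τ z.1) z.2) z := by
  -- Normalisation takes values in the sphere only off the origin, so it is corestricted as a map on
  -- the open submanifold `U`.
  let U : Opens (ℝ × E) := ⟨{z | z.2 ≠ 0}, isOpen_ne_fun continuous_snd continuous_const⟩
  rw [← contMDiffAt_iff_contDiffAt]
  refine (contMDiffAt_subtype_iff (U := U) (x := ⟨z, hz⟩)
    (f := fun z : ℝ × E => rayExt (τ z.1) z.2)).1 ?_
  have h1 : ContMDiff 𝓘(ℝ, ℝ × E) 𝓘(ℝ, E) ∞ (fun u : U => ‖u.1.2‖⁻¹ • u.1.2) := by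
    intro u
    refine (contMDiffAt_subtype_iff (U := U) (x := u)
      (f := fun z : ℝ × E => ‖z.2‖⁻¹ • z.2)).2 ?_
    rw [contMDiffAt_iff_contDiffAt]
    have hu : u.1.2 ≠ 0 := u.2
    exact ((contDiffAt_snd.norm ℝ hu).inv (norm_ne_zero_iff.2 hu)).smul contDiffAt_snd
  have h2 : ∀ u : U, ‖u.1.2‖⁻¹ • u.1.2 ∈ Metric.sphere (0 : E) 1 := by
    intro u
    have hu : u.1.2 ≠ 0 := u.2
    rw [mem_sphere_zero_iff_norm, norm_smul, norm_inv, norm_norm,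
      inv_mul_cancel₀ (norm_ne_zero_iff.mpr hu)]
  have h3 := h1.codRestrict_sphere (n := n) h2
  have h4 : ContMDiff 𝓘(ℝ, ℝ × E) 𝓘(ℝ, ℝ) ∞ (fun u : U => u.1.1) := by
    intro u
    refine (contMDiffAt_subtype_iff (U := U) (x := u)
      (f := fun z : ℝ × E => z.1)).2 ?_
    rw [contMDiffAt_iff_contDiffAt]
    exact contDiffAt_fst
  have h5 := (hτ.comp (h4.prodMk h3)).contMDiffAt (x := (⟨z, hz⟩ : U))
  refine h5.congr_of_eventuallyEq (Filter.Eventually.of_forall fun u => ?_)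
  have hu : u.1.2 ≠ 0 := u.2
  simp only [rayExt, dif_neg hu]
  rfl

theorem contDiffOn_rayExt {n : ℕ} [Fact (finrank ℝ E = n + 1)]
    {φ : Metric.sphere (0 : E) 1 → F} (hφ : ContMDiff (𝓡 n) 𝓘(ℝ, F) ∞ φ) :
    ContDiffOn ℝ ∞ (rayExt φ) {0}ᶜ := by
  intro y hy
  have h1 : ContMDiff (𝓘(ℝ, ℝ).prod (𝓡 n)) 𝓘(ℝ, F) ∞
      (fun z : ℝ × Metric.sphere (0 : E) 1 => φ z.2) := hφ.comp contMDiff_snd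
  have h2 := contDiffAt_rayExt_family (τ := fun _ => φ) h1 (z := ((0 : ℝ), y)) hy
  exact (h2.comp y (contDiffAt_const.prodMk contDiffAt_id)).contDiffWithinAt

theorem contMDiff_restrict_sphere {n : ℕ} [Fact (finrank ℝ E = n + 1)] {h : E → F}
    (hh : ContDiffOn ℝ ∞ h {0}ᶜ) :
    ContMDiff (𝓡 n) 𝓘(ℝ, F) ∞ (fun x : Metric.sphere (0 : E) 1 => h x) := by
  intro x
  have h0 : (x : E) ≠ 0 := ne_zero_of_mem_unit_sphere x
  have h1 : ContDiffAt ℝ ∞ h x := (hh x h0).contDiffAt (isOpen_compl_singleton.mem_nhds h0)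
  exact h1.contMDiffAt.comp x (contMDiff_coe_sphere x)

/-- A function invariant under positive scalings has vanishing radial derivative. -/
theorem fderiv_self_of_homogeneous {h : E → F}
    (hr : ∀ r : ℝ, 0 < r → ∀ y, h (r • y) = h y) {y : E} (hd : DifferentiableAt ℝ h y) :
    fderiv ℝ h y y = 0 := by
  have h1 : HasDerivAt (fun r : ℝ => r • y) y 1 := by
    simpa using (hasDerivAt_id (1 : ℝ)).smul_const y
  have hd' : HasFDerivAt h (fderiv ℝ h y) ((1 : ℝ) • y) := by
    rw [one_smul]; exact hd.hasFDerivAt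
  have h2 := hd'.comp_hasDerivAt 1 h1
  have h3 : HasDerivAt (h ∘ fun r : ℝ => r • y) 0 1 := by
    refine (hasDerivAt_const (1 : ℝ) (h y)).congr_of_eventuallyEq ?_
    filter_upwards [lt_mem_nhds (show (0 : ℝ) < 1 from one_pos)] with r hr'
    exact hr r hr' y
  exact h2.unique h3

/-- Differentiate `h (r • z) = h z` in `z`: the derivative of a function homogeneous of degree 0 has
degree -1. -/
theorem fderiv_smul_of_homogeneous {h : E → F}
    (hr : ∀ r : ℝ, 0 < r → ∀ y, h (r • y) = h y) {y : E} {r : ℝ} (hr0 : 0 < r)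
    (hd : DifferentiableAt ℝ h (r • y)) (v : E) :
    fderiv ℝ h (r • y) v = r⁻¹ • fderiv ℝ h y v := by
  have h1 : HasFDerivAt (fun z : E => r • z) (r • ContinuousLinearMap.id ℝ E) y :=
    (hasFDerivAt_id y).const_smul r
  have h2 := HasFDerivAt.comp y hd.hasFDerivAt h1
  have h3 : (h ∘ fun z : E => r • z) = h := funext fun z => hr r hr0 z
  rw [h3] at h2
  rw [h2.fderiv]
  simp [smul_smul, inv_mul_cancel₀ hr0.ne']

end RayExtension

/-! ### Polar coordinates and integration by parts on the sphere. -/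

section SphereIntegration

open Set Measure

theorem integrable_volumeIoiPow {n : ℕ} {f : ℝ → ℝ}
    (hf : IntegrableOn (fun r => r ^ n * f r) (Ioi 0)) :
    Integrable (fun r : Ioi (0 : ℝ) => f r) (volumeIoiPow n) := by
  rw [integrableOn_iff_comap_subtypeVal measurableSet_Ioi] at hf
  rw [volumeIoiPow, integrable_withDensity_iff_integrable_smul' (by fun_prop) (by simp)]
  refine hf.congr (Filter.Eventually.of_forall ?_)
  rintro ⟨r, hr⟩
  have hr' : (0 : ℝ) ≤ r ^ n := pow_nonneg (le_of_lt hr) n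
  simp [ENNReal.toReal_ofReal hr']

theorem integral_volumeIoiPow (n : ℕ) (f : ℝ → ℝ) :
    ∫ r : Ioi (0 : ℝ), f r ∂(volumeIoiPow n) = ∫ r in Ioi (0 : ℝ), r ^ n * f r := by
  simp only [volumeIoiPow, ENNReal.ofReal]
  rw [integral_withDensity_eq_integral_smul,
    integral_subtype_comap measurableSet_Ioi fun a ↦ Real.toNNReal (a ^ n) • f a,
    setIntegral_congr_fun measurableSet_Ioi fun x hx ↦ ?_]
  · rw [NNReal.smul_def, Real.coe_toNNReal _ (pow_nonneg (le_of_lt hx) _), smul_eq_mul]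
  · exact (measurable_subtype_coe.pow_const _).real_toNNReal

variable {E : Type*} [NormedAddCommGroup E] [InnerProductSpace ℝ E] [FiniteDimensional ℝ E]
  [MeasurableSpace E] [BorelSpace E]

/-- Polar coordinates for a sum of two products of functions of the direction and the norm. -/
theorem integral_eq_of_polar (F : E → ℝ) {A B : Metric.sphere (0 : E) 1 → ℝ} {a b : ℝ → ℝ}
    (hA : Continuous A) (hB : Continuous B)
    (ha : IntegrableOn (fun r => r ^ (finrank ℝ E - 1) * a r) (Ioi 0))
    (hb : IntegrableOn (fun r => r ^ (finrank ℝ E - 1) * b r) (Ioi 0))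
    (hF : ∀ (x : Metric.sphere (0 : E) 1) (r : ℝ), 0 < r →
      F (r • (x : E)) = A x * a r + B x * b r) [Nontrivial E] :
    ∫ y, F y = (∫ x, A x ∂(volume : Measure E).toSphere) *
        (∫ r in Ioi (0 : ℝ), r ^ (finrank ℝ E - 1) * a r) +
      (∫ x, B x ∂(volume : Measure E).toSphere) *
        (∫ r in Ioi (0 : ℝ), r ^ (finrank ℝ E - 1) * b r) := by
  have hAi : Integrable A (volume : Measure E).toSphere :=
    hA.integrable_of_hasCompactSupport (HasCompactSupport.of_compactSpace A)
  have hBi : Integrable B (volume : Measure E).toSphere :=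
    hB.integrable_of_hasCompactSupport (HasCompactSupport.of_compactSpace B)
  calc ∫ y, F y = ∫ y : ({(0)}ᶜ : Set E), F y ∂((volume : Measure E).comap (↑)) := by
        rw [integral_subtype_comap (measurableSet_singleton _).compl fun x ↦ F x,
          restrict_compl_singleton]
    _ = ∫ z : Metric.sphere (0 : E) 1 × Ioi (0 : ℝ), A z.1 * a z.2 + B z.1 * b z.2
          ∂((volume : Measure E).toSphere.prod (volumeIoiPow (finrank ℝ E - 1))) := by
        rw [← (volume : Measure E).measurePreserving_homeomorphUnitSphereProd.integral_comp
          (Homeomorph.measurableEmbedding _)]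
        refine integral_congr_ae (Filter.Eventually.of_forall fun y => ?_)
        have hy : (0 : ℝ) < ‖(y : E)‖ := norm_pos_iff.2 y.2
        have := hF (homeomorphUnitSphereProd E y).1 ‖(y : E)‖ hy
        rw [homeomorphUnitSphereProd_apply_fst_coe, smul_smul, mul_inv_cancel₀ hy.ne',
          one_smul] at this
        simp only [this, homeomorphUnitSphereProd_apply_snd_coe]
    _ = _ := by
        rw [integral_add (hAi.mul_prod (integrable_volumeIoiPow ha))
          (hBi.mul_prod (integrable_volumeIoiPow hb)),
          integral_prod_mul A (fun r : Ioi (0 : ℝ) => a r),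
          integral_prod_mul B (fun r : Ioi (0 : ℝ) => b r),
          integral_volumeIoiPow, integral_volumeIoiPow]

theorem integral_fderiv_eq_zero_of_hasCompactSupport {G : E → ℝ} (hG : ContDiff ℝ 1 G)
    (hc : HasCompactSupport G) (v : E) : ∫ y, fderiv ℝ G y v = 0 := by
  have hd : Continuous fun y => fderiv ℝ G y v :=
    (hG.continuous_fderiv one_ne_zero).clm_apply continuous_const
  have hdc : HasCompactSupport fun y => fderiv ℝ G y v := hc.fderiv_apply ℝ v
  -- Integration by parts against the constant function 1.
  have := integral_mul_fderiv_eq_neg_fderiv_mul_of_integrable (μ := (volume : Measure E))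
    (f := fun _ : E => (1 : ℝ)) (g := G) (v := v) (by simp)
    (by simpa using hd.integrable_of_hasCompactSupport hdc)
    (by simpa using hG.continuous.integrable_of_hasCompactSupport hc)
    (fun x _ => differentiableAt_const _) (fun x _ => hG.differentiable one_ne_zero x)
  simpa using this

theorem continuous_mul_inv_of_eq_zero {ρ : ℝ → ℝ} (hρ : Continuous ρ) (h1 : ∀ r ≤ 1, ρ r = 0) :
    Continuous fun r => ρ r * r⁻¹ := by
  have h : (fun r => ρ r * r⁻¹) = fun r => ρ r * (max r 1)⁻¹ := by
    funext r
    rcases le_total r 1 with hr | hr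
    · simp [h1 r hr]
    · rw [max_eq_left hr]
  rw [h]
  refine hρ.mul ((continuous_id.max continuous_const).inv₀ fun r => ?_)
  exact (lt_of_lt_of_le one_pos (le_max_right _ _)).ne'

/-- Integrate the derivative of `r ^ n * ρ r`. The vanishing of `ρ` up to 1 kills the boundary term
at 0 and makes `r⁻¹` harmless. -/
theorem integral_pow_mul_deriv {ρ : ℝ → ℝ} (hρ : ContDiff ℝ 1 ρ) (hc : HasCompactSupport ρ)
    (h1 : ∀ r ≤ 1, ρ r = 0) (n : ℕ) :
    ∫ r in Ioi (0 : ℝ), r ^ n * deriv ρ r = -(n * ∫ r in Ioi (0 : ℝ), r ^ n * (ρ r * r⁻¹)) := by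
  have hG : ContDiff ℝ 1 fun r : ℝ => r ^ n * ρ r := (contDiff_id.pow n).mul hρ
  have hGc : HasCompactSupport fun r : ℝ => r ^ n * ρ r := hc.mul_left
  have h2 := hGc.integral_Ioi_deriv_eq hG 0
  rw [h1 0 zero_le_one, mul_zero, neg_zero] at h2
  have hi1 : Integrable fun r : ℝ => r ^ n * deriv ρ r :=
    ((continuous_pow n).mul (hρ.continuous_deriv le_rfl)).integrable_of_hasCompactSupport
      hc.deriv.mul_left
  have hi2 : Integrable fun r : ℝ => n * (r ^ n * (ρ r * r⁻¹)) :=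
    (continuous_const.mul ((continuous_pow n).mul
      (continuous_mul_inv_of_eq_zero hρ.continuous h1))).integrable_of_hasCompactSupport
      hc.mul_right.mul_left.mul_left
  have h3 : ∫ r in Ioi (0 : ℝ), deriv (fun r : ℝ => r ^ n * ρ r) r =
      ∫ r in Ioi (0 : ℝ), (r ^ n * deriv ρ r + n * (r ^ n * (ρ r * r⁻¹))) := by
    refine setIntegral_congr_fun measurableSet_Ioi fun r hr => ?_
    have hr0 : r ≠ 0 := ne_of_gt hr
    have hd := (hasDerivAt_pow n r).mul (hρ.differentiable one_ne_zero r).hasDerivAt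
    change deriv ((fun r => r ^ n) * ρ) r = _
    rw [hd.deriv]
    rcases n with _ | n
    · simp
    · simp only [Nat.add_sub_cancel, pow_succ]
      field_simp
      ring
  rw [h3, integral_add hi1.integrableOn hi2.integrableOn, integral_const_mul] at h2
  linarith

/-- Integration by parts on the unit sphere: for a function `h` that is constant on rays,
`∫ D_v h = (dim E - 1) ∫ h ⟪x, v⟫`. -/
theorem integral_sphere_fderiv [Nontrivial E] {h : E → ℝ} (hh : ContDiffOn ℝ ∞ h {0}ᶜ)
    (hr : ∀ r : ℝ, 0 < r → ∀ y, h (r • y) = h y) (v : E) :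
    ∫ x : Metric.sphere (0 : E) 1, fderiv ℝ h x v ∂(volume : Measure E).toSphere =
      (finrank ℝ E - 1 : ℕ) *
        ∫ x : Metric.sphere (0 : E) 1, h x * ⟪(x : E), v⟫_ℝ ∂(volume : Measure E).toSphere := by
  have hat : ∀ y : E, y ≠ 0 → ContDiffAt ℝ ∞ h y := fun y hy =>
    (hh y hy).contDiffAt (isOpen_compl_singleton.mem_nhds hy)
  -- A radial cutoff vanishing outside `(1, 5)`, away from the origin, where `h` may be singular.
  let ρ : ContDiffBump (3 : ℝ) := ⟨1, 2, one_pos, one_lt_two⟩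
  have hρ : ContDiff ℝ 1 ρ := ρ.contDiff
  have hρc : HasCompactSupport ρ := ρ.hasCompactSupport
  have hρ1 : ∀ r ≤ 1, ρ r = 0 := fun r hr => by
    refine ρ.zero_of_le_dist ?_
    rw [Real.dist_eq, abs_sub_comm]
    exact le_trans (by change (2 : ℝ) ≤ 3 - r; linarith) (le_abs_self _)
  have hρ5 : ∀ r, 5 ≤ r → ρ r = 0 := fun r hr => by
    refine ρ.zero_of_le_dist ?_
    rw [Real.dist_eq]
    exact le_trans (by change (2 : ℝ) ≤ r - 3; linarith) (le_abs_self _)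
  set N := finrank ℝ E - 1
  set G : E → ℝ := fun y => ρ ‖y‖ * h y with hGdef
  have hG : ContDiff ℝ 1 G := by
    rw [contDiff_iff_contDiffAt]
    intro y
    by_cases hy : y = 0
    · subst hy
      refine (contDiffAt_const (c := (0 : ℝ))).congr_of_eventuallyEq ?_
      filter_upwards [Metric.ball_mem_nhds (0 : E) one_pos] with z hz
      rw [hGdef]
      simp [hρ1 ‖z‖ (by simpa using (mem_ball_zero_iff.1 hz).le)]
    · exact (hρ.contDiffAt.comp y (contDiffAt_id.norm ℝ hy)).mul
        ((hat y hy).of_le (by exact_mod_cast le_top))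
  have hGc : HasCompactSupport G := by
    refine HasCompactSupport.intro (isCompact_closedBall (0 : E) 5) fun y hy => ?_
    have : 5 ≤ ‖y‖ := by
      rw [mem_closedBall_zero_iff, not_le] at hy
      exact hy.le
    simp [hGdef, hρ5 _ this]
  have hcont : Continuous fun x : Metric.sphere (0 : E) 1 => h x := by
    rw [continuous_iff_continuousAt]
    intro x
    exact (hat x (ne_zero_of_mem_unit_sphere x)).continuousAt.comp
      continuous_subtype_val.continuousAt
  have hdcont : Continuous fun x : Metric.sphere (0 : E) 1 => fderiv ℝ h x v := by
    rw [continuous_iff_continuousAt]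
    intro x
    have h1 : ContinuousAt (fderiv ℝ h) x :=
      ((hat x (ne_zero_of_mem_unit_sphere x)).fderiv_right (m := 0)
        (by exact_mod_cast le_top)).continuousAt
    exact (h1.comp continuous_subtype_val.continuousAt).clm_apply continuousAt_const
  -- At `r • x` the derivative of `ρ ‖y‖ * h y` along `v` is `ρ'(r) ⟪x, v⟫ h x + ρ(r) r⁻¹ D_v h(x)`.
  -- Its total integral is 0, and both radial integrals are multiples of the same one.
  have key := integral_eq_of_polar (fun y => fderiv ℝ G y v)
    (A := fun x => h x * ⟪(x : E), v⟫_ℝ) (B := fun x => fderiv ℝ h x v)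
    (a := deriv ρ) (b := fun r => ρ r * r⁻¹)
    (hcont.mul (continuous_subtype_val.inner continuous_const)) hdcont
    (((continuous_pow N).mul (hρ.continuous_deriv le_rfl)).integrable_of_hasCompactSupport
      hρc.deriv.mul_left).integrableOn
    (((continuous_pow N).mul
      (continuous_mul_inv_of_eq_zero hρ.continuous hρ1)).integrable_of_hasCompactSupport
      hρc.mul_right.mul_left).integrableOn
    (by
      intro x r hr0
      have hx0 : (x : E) ≠ 0 := ne_zero_of_mem_unit_sphere x
      have hx1 : ‖(x : E)‖ = 1 := by simp
      have hne : r • (x : E) ≠ 0 := smul_ne_zero hr0.ne' hx0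
      have hnorm : ‖r • (x : E)‖ = r := by rw [norm_smul, hx1, mul_one, Real.norm_of_nonneg hr0.le]
      have hdn : HasFDerivAt (fun y : E => ‖y‖) (innerSL ℝ (x : E)) (r • (x : E)) := by
        have h1 := (hasStrictFDerivAt_norm_sq (r • (x : E))).hasFDerivAt.sqrt
          (by rw [hnorm]; positivity)
        have h2 : (fun y : E => √(‖y‖ ^ 2)) = fun y => ‖y‖ := by
          funext y; exact Real.sqrt_sq (norm_nonneg y)
        rw [h2, hnorm, Real.sqrt_sq hr0.le] at h1
        convert h1 using 1
        ext w
        simp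
        field_simp
      have hdρ : HasFDerivAt (fun y : E => ρ ‖y‖) (deriv ρ r • innerSL ℝ (x : E))
          (r • (x : E)) := by
        have h1 : HasDerivAt ρ (deriv ρ r) ‖r • (x : E)‖ := by
          rw [hnorm]; exact (hρ.differentiable one_ne_zero r).hasDerivAt
        exact h1.comp_hasFDerivAt _ hdn
      have hdh : DifferentiableAt ℝ h (r • (x : E)) :=
        (hat _ hne).differentiableAt (by simp)
      have hdG := hdρ.mul hdh.hasFDerivAt
      change fderiv ℝ ((fun y => ρ ‖y‖) * h) _ v = _
      rw [hdG.fderiv]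
      simp [fderiv_smul_of_homogeneous hr hr0 hdh, hnorm, hr r hr0]
      ring)
  rw [integral_fderiv_eq_zero_of_hasCompactSupport hG hGc v,
    integral_pow_mul_deriv hρ hρc hρ1] at key
  -- The common radial factor is nonzero, so it can be cancelled.
  have hpos : 0 < ∫ r in Ioi (0 : ℝ), r ^ N * (ρ r * r⁻¹) := by
    have hi : IntegrableOn (fun r : ℝ => r ^ N * (ρ r * r⁻¹)) (Ioi 0) :=
      (((continuous_pow N).mul
        (continuous_mul_inv_of_eq_zero hρ.continuous hρ1)).integrable_of_hasCompactSupport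
        hρc.mul_right.mul_left).integrableOn
    rw [setIntegral_pos_iff_support_of_nonneg_ae _ hi]
    · refine lt_of_lt_of_le ?_ (measure_mono (s := Ioo (2 : ℝ) 4) ?_)
      · simp
        norm_num
      · intro r hr
        have hr0 : (0 : ℝ) < r := by linarith [hr.1]
        refine ⟨?_, hr0⟩
        have : 0 < ρ r := ρ.pos_of_mem_ball (by
          rw [Metric.mem_ball, Real.dist_eq, abs_lt]
          change -(2 : ℝ) < _ ∧ _ < (2 : ℝ)
          constructor <;> linarith [hr.1, hr.2])
        have : 0 < r ^ N * (ρ r * r⁻¹) := by positivity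
        exact this.ne'
    · filter_upwards [ae_restrict_mem measurableSet_Ioi] with r hr
      have hr' : (0 : ℝ) < r := hr
      have : 0 ≤ ρ r := ρ.nonneg
      show 0 ≤ r ^ N * (ρ r * r⁻¹)
      positivity
  have := hpos.ne'
  have h2 : ((∫ x : Metric.sphere (0 : E) 1, fderiv ℝ h x v ∂(volume : Measure E).toSphere) -
      N * ∫ x : Metric.sphere (0 : E) 1, h x * ⟪(x : E), v⟫_ℝ ∂(volume : Measure E).toSphere) *
      (∫ r in Ioi (0 : ℝ), r ^ N * (ρ r * r⁻¹)) = 0 := by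
    linarith
  rcases mul_eq_zero.1 h2 with h3 | h3
  · linarith
  · exact absurd h3 this

end SphereIntegration

/-! ### The energy density as a function of a field and its first derivatives. -/

section Jets

variable {E : Type*} [NormedAddCommGroup E] [InnerProductSpace ℝ E]

/-- The energy density in terms of the value `u` of a vector field and its derivatives `d a`. -/
def jetDensity {ι : Type*} [Fintype ι] (p q : ℝ) (u : E) (d : ι → E) : ℝ :=
  (1 + ‖u‖ ^ 2) ^ (-p) * (∑ a, ‖d a‖ ^ 2 - ‖u‖ ^ 2 + q * ∑ a, ⟪d a, u⟫_ℝ ^ 2)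

/-- Half the derivative of `jetDensity p q` at `(u, d)` in the direction `(v, d')`. -/
def jetVariation {ι : Type*} [Fintype ι] (p q : ℝ) (u v : E) (d d' : ι → E) : ℝ :=
  (1 + ‖u‖ ^ 2) ^ (-p) * (∑ a, ⟪d a, d' a⟫_ℝ - ⟪u, v⟫_ℝ +
      q * ∑ a, ⟪d a, u⟫_ℝ * (⟪d' a, u⟫_ℝ + ⟪d a, v⟫_ℝ)) -
    p * (1 + ‖u‖ ^ 2) ^ (-p - 1) * ⟪u, v⟫_ℝ *
      (∑ a, ‖d a‖ ^ 2 - ‖u‖ ^ 2 + q * ∑ a, ⟪d a, u⟫_ℝ ^ 2)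

theorem hasDerivAt_jetDensity {ι : Type*} [Fintype ι] (p q : ℝ) {u : ℝ → E} {d : ι → ℝ → E}
    {v : E} {d' : ι → E} {t : ℝ} (hu : HasDerivAt u v t) (hd : ∀ a, HasDerivAt (d a) (d' a) t) :
    HasDerivAt (fun t => jetDensity p q (u t) (fun a => d a t))
      (2 * jetVariation p q (u t) v (fun a => d a t) d') t := by
  have hn := hu.norm_sq
  have hpos : 1 + ‖u t‖ ^ 2 ≠ 0 := by positivity
  have hw := (hn.const_add 1).rpow_const (p := -p) (Or.inl hpos)
  have hs := HasDerivAt.fun_sum (u := Finset.univ) fun a _ => (hd a).norm_sq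
  have hs' := HasDerivAt.fun_sum (u := Finset.univ) fun a _ => ((hd a).inner ℝ hu).fun_pow 2
  have hfin := hw.fun_mul ((hs.fun_sub hn).fun_add (hs'.const_mul q))
  refine hfin.congr_deriv ?_
  have h6 : ∀ a, ((2 : ℕ) : ℝ) * ⟪d a t, u t⟫_ℝ ^ (2 - 1) * (⟪d a t, v⟫_ℝ + ⟪d' a, u t⟫_ℝ) =
      2 * (⟪d a t, u t⟫_ℝ * (⟪d' a, u t⟫_ℝ + ⟪d a t, v⟫_ℝ)) := by
    intro a
    norm_num
    ring
  simp only [h6, jetVariation, ← Finset.mul_sum]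
  ring

theorem contDiffAt_jetDensity {ι : Type*} [Fintype ι] (p q : ℝ) {G : Type*}
    [NormedAddCommGroup G] [NormedSpace ℝ G] {u : G → E} {d : ι → G → E} {z : G}
    (hu : ContDiffAt ℝ 1 u z) (hd : ∀ a, ContDiffAt ℝ 1 (d a) z) :
    ContDiffAt ℝ 1 (fun z => jetDensity p q (u z) (fun a => d a z)) z := by
  have hn : ContDiffAt ℝ 1 (fun z => ‖u z‖ ^ 2) z := hu.norm_sq ℝ
  refine ((contDiffAt_const.add hn).rpow_const_of_ne ?_).mul
    (((ContDiffAt.sum fun a _ => (hd a).norm_sq ℝ).sub hn).add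
      (contDiffAt_const.mul (ContDiffAt.sum fun a _ => ((hd a).inner ℝ hu).pow 2)))
  positivity

theorem hasDerivAt_apply_fst {G H : Type*} [NormedAddCommGroup G] [NormedSpace ℝ G]
    [NormedAddCommGroup H] [NormedSpace ℝ H] {D : ℝ × G → (ℝ × G →L[ℝ] H)}
    {D' : ℝ × G →L[ℝ] (ℝ × G →L[ℝ] H)} {t : ℝ} {y : G}
    (h2 : HasFDerivAt D D' (t,y)) (v : G) :
    HasDerivAt (fun s : ℝ => D (s, y) (0, v)) (D' (1, 0) (0, v)) t := by
  have htime : HasDerivAt (fun t : ℝ => ((t, y) : ℝ × G)) (1, 0) t :=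
    (hasDerivAt_id t).prodMk (hasDerivAt_const t y)
  have h3 := h2.clm_apply (hasFDerivAt_const ((0 : ℝ), v) (t, y))
  refine (h3.comp_hasDerivAt t htime).congr_deriv ?_
  simp
theorem fderiv_apply_snd {G H : Type*} [NormedAddCommGroup G] [NormedSpace ℝ G]
    [NormedAddCommGroup H] [NormedSpace ℝ H] {D : ℝ × G → (ℝ × G →L[ℝ] H)}
    {D' : ℝ × G →L[ℝ] (ℝ × G →L[ℝ] H)} {t : ℝ} {y : G}
    (h2 : HasFDerivAt D D' (t,y)) (v : G) :
    fderiv ℝ (fun w : G => D (t, w) (1, 0)) y v = D' (0, v) (1, 0) := by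
  have h3 : HasFDerivAt (fun w : G => D (t, w)) (D'.comp (ContinuousLinearMap.inr ℝ ℝ G)) y :=
    HasFDerivAt.comp y h2 (hasFDerivAt_prodMk_right t y)
  have h4 := h3.clm_apply
    (hasFDerivAt_const ((1 : ℝ), (0 : G)) y)
  rw [h4.fderiv]
  simp
-- Symmetry of the second derivative exchanges the time and space derivatives.
theorem hasDerivAt_fderiv_swap {G H : Type*} [NormedAddCommGroup G] [NormedSpace ℝ G]
    [NormedAddCommGroup H] [NormedSpace ℝ H] {U : ℝ × G → H} {t : ℝ} {y : G}
    (hU : ContDiffAt ℝ ∞ U (t, y)) (v : G) :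
    HasDerivAt (fun s : ℝ => fderiv ℝ U (s, y) (0, v))
      (fderiv ℝ (fun w : G => fderiv ℝ U (t, w) (1, 0)) y v) t := by
  have hc : ContDiffAt ℝ 1 (fderiv ℝ U) (t, y) :=
    hU.fderiv_right (WithTop.coe_le_coe.2 le_top)
  have h2 : HasFDerivAt (fderiv ℝ U) (fderiv ℝ (fderiv ℝ U) (t, y)) (t, y) :=
    (hc.differentiableAt one_ne_zero).hasFDerivAt
  rw [fderiv_apply_snd h2]
  have hs : minSmoothness ℝ 2 ≤ ∞ := by
    rw [minSmoothness_of_isRCLikeNormedField]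
    exact WithTop.coe_le_coe.2 le_top
  have hsymm : IsSymmSndFDerivAt ℝ U (t, y) := hU.isSymmSndFDerivAt hs
  rw [hsymm.eq]
  exact hasDerivAt_apply_fst h2 v

end Jets

/-! ### Time derivatives of variations extended along rays. -/

section Family

variable {E : Type*} [NormedAddCommGroup E] [InnerProductSpace ℝ E]
variable {n : ℕ} [Fact (finrank ℝ E = n + 1)] {τ : ℝ → Metric.sphere (0 : E) 1 → E}

theorem contDiffAt_fderiv_rayExt_family
    (hτ : ContMDiff (𝓘(ℝ, ℝ).prod (𝓡 n)) 𝓘(ℝ, E) ∞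
      (fun z : ℝ × Metric.sphere (0 : E) 1 => τ z.1 z.2)) {z : ℝ × E} (hz : z.2 ≠ 0) :
    ContDiffAt ℝ 1 (fderiv ℝ fun z : ℝ × E => rayExt (τ z.1) z.2) z :=
  (contDiffAt_rayExt_family hτ hz).fderiv_right (WithTop.coe_le_coe.2 le_top)

theorem hasFDerivAt_rayExt_family
    (hτ : ContMDiff (𝓘(ℝ, ℝ).prod (𝓡 n)) 𝓘(ℝ, E) ∞
      (fun z : ℝ × Metric.sphere (0 : E) 1 => τ z.1 z.2)) (t : ℝ) {y : E} (hy : y ≠ 0) :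
    HasFDerivAt (rayExt (τ t)) ((fderiv ℝ (fun z : ℝ × E => rayExt (τ z.1) z.2) (t, y)).comp
      (ContinuousLinearMap.inr ℝ ℝ E)) y := by
  have h1 : HasFDerivAt (fun w : E => (t, w)) (ContinuousLinearMap.inr ℝ ℝ E) y :=
    hasFDerivAt_prodMk_right t y
  exact ((contDiffAt_rayExt_family hτ (z := (t, y)) hy).differentiableAt
    (by simp)).hasFDerivAt.comp y h1

theorem rayExt_eq_fderiv_time
    (hτ : ContMDiff (𝓘(ℝ, ℝ).prod (𝓡 n)) 𝓘(ℝ, E) ∞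
      (fun z : ℝ × Metric.sphere (0 : E) 1 => τ z.1 z.2)) {V : Metric.sphere (0 : E) 1 → E}
    (hV : ∀ x, HasDerivAt (fun t => τ t x) (V x) 0) {y : E} (hy : y ≠ 0) :
    rayExt V y = fderiv ℝ (fun z : ℝ × E => rayExt (τ z.1) z.2) (0, y) (1, 0) := by
  have htime : HasDerivAt (fun t : ℝ => ((t, y) : ℝ × E)) (1, 0) 0 :=
    (hasDerivAt_id (0 : ℝ)).prodMk (hasDerivAt_const 0 y)
  have h1 := ((contDiffAt_rayExt_family hτ (z := (0, y)) hy).differentiableAt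
    (by simp)).hasFDerivAt.comp_hasDerivAt 0 htime
  refine HasDerivAt.unique ?_ h1
  have h2 : ((fun z : ℝ × E => rayExt (τ z.1) z.2) ∘ fun t => (t, y)) =
      fun t => τ t ⟨‖y‖⁻¹ • y, by
        rw [mem_sphere_zero_iff_norm, norm_smul, norm_inv, norm_norm,
          inv_mul_cancel₀ (norm_ne_zero_iff.mpr hy)]⟩ := by
    funext t
    simp only [Function.comp, rayExt, dif_neg hy]
  rw [h2, rayExt, dif_neg hy]
  exact hV _

/-- The time derivative of the spatial derivatives of a variation is the spatial derivative of
the variation field. -/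
theorem hasDerivAt_fderiv_rayExt_family
    (hτ : ContMDiff (𝓘(ℝ, ℝ).prod (𝓡 n)) 𝓘(ℝ, E) ∞
      (fun z : ℝ × Metric.sphere (0 : E) 1 => τ z.1 z.2)) {V : Metric.sphere (0 : E) 1 → E}
    (hV : ∀ x, HasDerivAt (fun t => τ t x) (V x) 0) {y : E} (hy : y ≠ 0) (v : E) :
    HasDerivAt (fun t : ℝ => fderiv ℝ (fun z : ℝ × E => rayExt (τ z.1) z.2) (t, y) (0, v))
      (fderiv ℝ (rayExt V) y v) 0 := by
  refine (hasDerivAt_fderiv_swap (contDiffAt_rayExt_family hτ (z := (0, y)) hy)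
    v).congr_deriv ?_
  have h5 : rayExt V =ᶠ[nhds y]
      fun y : E => fderiv ℝ (fun z : ℝ × E => rayExt (τ z.1) z.2) (0, y) (1, 0) := by
    filter_upwards [isOpen_compl_singleton.mem_nhds hy] with w hw
    exact rayExt_eq_fderiv_time hτ hV hw
  rw [h5.fderiv_eq]

end Family

/-! ### The vertical energy density in ambient terms. -/

section EnergyDensity

variable {E : Type*} [NormedAddCommGroup E] [InnerProductSpace ℝ E]

theorem mem_tangentPlane_iff {x : Metric.sphere (0 : E) 1} {v : E} :
    v ∈ tangentPlane x ↔ ⟪(x : E), v⟫_ℝ = 0 :=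
  Submodule.mem_orthogonal_singleton_iff_inner_right

theorem starProjection_tangentPlane (x : Metric.sphere (0 : E) 1) (v : E) :
    (tangentPlane x).starProjection v = v - ⟪(x : E), v⟫_ℝ • (x : E) := by
  have hx : ‖(x : E)‖ = 1 := by simp
  rw [Submodule.starProjection_orthogonal_val, Submodule.starProjection_unit_singleton ℝ hx]

theorem norm_sq_starProjection_tangentPlane (x : Metric.sphere (0 : E) 1) (v : E) :
    ‖(tangentPlane x).starProjection v‖ ^ 2 = ‖v‖ ^ 2 - ⟪(x : E), v⟫_ℝ ^ 2 := by
  have hx : ‖(x : E)‖ = 1 := by simp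
  rw [starProjection_tangentPlane, norm_sub_sq_real, norm_smul, hx, inner_smul_right,
    real_inner_comm, Real.norm_eq_abs, mul_one, sq_abs]
  ring

theorem inner_starProjection_tangentPlane {x : Metric.sphere (0 : E) 1} {e : E}
    (he : e ∈ tangentPlane x) (v : E) :
    ⟪(tangentPlane x).starProjection v, e⟫_ℝ = ⟪v, e⟫_ℝ := by
  rw [starProjection_tangentPlane, inner_sub_left, inner_smul_left,
    mem_tangentPlane_iff.1 he, mul_zero, sub_zero]

/-- A smooth vector field on the sphere has radially extended inner product zero with the
position vector. -/
theorem inner_rayExt_self {σ : Metric.sphere (0 : E) 1 → E} (ht : ∀ x, σ x ∈ tangentPlane x)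
    (y : E) : ⟪rayExt σ y, y⟫_ℝ = 0 := by
  by_cases hy : y = 0
  · simp [hy]
  · rw [rayExt, dif_neg hy]
    have h := mem_tangentPlane_iff.1 (ht ⟨‖y‖⁻¹ • y, by
      rw [mem_sphere_zero_iff_norm, norm_smul, norm_inv, norm_norm,
        inv_mul_cancel₀ (norm_ne_zero_iff.mpr hy)]⟩)
    rw [inner_smul_left] at h
    rcases mul_eq_zero.1 h with h | h
    · simp [hy] at h
    · rw [real_inner_comm]; exact h

/-- Differentiate `⟪rayExt σ y, y⟫ = 0`. On the sphere this is the normal component removed in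
passing to the covariant derivative. -/
theorem inner_fderiv_rayExt_self {σ : Metric.sphere (0 : E) 1 → E}
    (ht : ∀ x, σ x ∈ tangentPlane x) {y : E} (hd : DifferentiableAt ℝ (rayExt σ) y) (v : E) :
    ⟪y, fderiv ℝ (rayExt σ) y v⟫_ℝ = -⟪rayExt σ y, v⟫_ℝ := by
  have h1 := hd.hasFDerivAt.inner ℝ (hasFDerivAt_id y)
  have h2 : (fun t : E => ⟪rayExt σ t, id t⟫_ℝ) = fun _ => 0 :=
    funext fun t => inner_rayExt_self ht t
  rw [h2] at h1
  have h3 := congrArg (fun T : E →L[ℝ] ℝ => T v) (h1.unique (hasFDerivAt_const (0 : ℝ) y))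
  simp at h3
  rw [real_inner_comm]
  linarith

variable [FiniteDimensional ℝ E]

/-- The Hilbert–Schmidt norm of a map killing `x` can be computed on the tangent plane at `x`. -/
theorem sum_norm_sq_tangentPlane {F : Type*} [NormedAddCommGroup F] [InnerProductSpace ℝ F]
    [FiniteDimensional ℝ F] {x : Metric.sphere (0 : E) 1} {T : E →L[ℝ] F} (hT : T x = 0) :
    ∑ i, ‖T (stdOrthonormalBasis ℝ (tangentPlane x) i)‖ ^ 2 =
      ∑ a, ‖T (stdOrthonormalBasis ℝ E a)‖ ^ 2 := by
  have := FiniteDimensional.complete ℝ E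
  have := FiniteDimensional.complete ℝ F
  let f := stdOrthonormalBasis ℝ F
  -- Since `T x = 0`, the adjoint takes values in the tangent plane, so Parseval in the plane and in
  -- `E` give the same sum.
  have h1 : ∀ c, T.adjoint (f c) ∈ tangentPlane x := fun c => by
    rw [mem_tangentPlane_iff, ContinuousLinearMap.adjoint_inner_right, hT, inner_zero_left]
  simp_rw [← f.sum_sq_norm_inner_right, ← ContinuousLinearMap.adjoint_inner_left]
  rw [Finset.sum_comm, Finset.sum_comm (s := Finset.univ (α := Fin (finrank ℝ E)))]
  refine Finset.sum_congr rfl fun c _ => ?_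
  rw [OrthonormalBasis.sum_sq_norm_inner_left]
  have h2 := (stdOrthonormalBasis ℝ (tangentPlane x)).sum_sq_norm_inner_left ⟨_, h1 c⟩
  simpa using h2

/-- The normal component of `D_v σ` is `-⟪σ, v⟫`, and its squares sum to `‖σ‖²`: this is the
subtracted term in `jetDensity`. The trace extends from the tangent plane to `E` because the radial
derivative vanishes. -/
theorem vertEnergyDensity_eq (p q : ℝ) {σ : Metric.sphere (0 : E) 1 → E}
    (ht : ∀ x, σ x ∈ tangentPlane x) {x : Metric.sphere (0 : E) 1}
    (hd : DifferentiableAt ℝ (rayExt σ) (x : E)) :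
    vertEnergyDensity p q σ x = jetDensity p q (σ x)
      (fun a => fderiv ℝ (rayExt σ) x (stdOrthonormalBasis ℝ E a)) := by
  set L := fderiv ℝ (rayExt σ) (x : E) with hL
  have hLx : L x = 0 := fderiv_self_of_homogeneous (fun r hr y => rayExt_smul σ hr y) hd
  have hw : (1 / (1 + ‖σ x‖ ^ 2)) ^ p = (1 + ‖σ x‖ ^ 2) ^ (-p) := by
    rw [one_div, Real.inv_rpow (by positivity), Real.rpow_neg (by positivity)]
  have h1 : ∀ X : E, pqMetric p q x (σ x) (vertDiff σ x X) (vertDiff σ x X) =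
      (1 + ‖σ x‖ ^ 2) ^ (-p) *
        (‖((tangentPlane x).starProjection ∘L L) X‖ ^ 2 + q * ‖(innerSL ℝ (σ x) ∘L L) X‖ ^ 2) := by
    intro X
    have hK : connectionMap x (vertDiff σ x X) = (tangentPlane x).starProjection (L X) := by
      -- `rayExt` unfolds to the same expression as `radialExt`, and `K` is applied twice: once in
      -- `covDeriv`, once in the metric.
      change (tangentPlane x).starProjection ((tangentPlane x).starProjection (L X)) = _
      exact Submodule.starProjection_eq_self_iff.2 (Submodule.starProjection_apply_mem _ _)
    rw [pqMetric, hw, hK, inner_starProjection_tangentPlane (ht x)]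
    simp only [vertDiff, real_inner_self_eq_norm_sq, norm_zero, ContinuousLinearMap.comp_apply,
      innerSL_apply_apply, Real.norm_eq_abs, sq_abs, real_inner_comm (σ x)]
    ring
  have h2 := sum_norm_sq_tangentPlane (x := x) (T := (tangentPlane x).starProjection ∘L L)
    (by simp [hLx])
  have h3 := sum_norm_sq_tangentPlane (x := x) (T := innerSL ℝ (σ x) ∘L L) (by simp [hLx])
  have h4 : ∀ v : E, ‖((tangentPlane x).starProjection ∘L L) v‖ ^ 2 =
      ‖L v‖ ^ 2 - ‖⟪σ x, v⟫_ℝ‖ ^ 2 := by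
    intro v
    have h5 := inner_fderiv_rayExt_self ht hd v
    rw [rayExt_coe] at h5
    rw [ContinuousLinearMap.comp_apply, norm_sq_starProjection_tangentPlane, h5, neg_sq,
      Real.norm_eq_abs, sq_abs]
  rw [vertEnergyDensity, jetDensity]
  simp_rw [h1]
  rw [← Finset.mul_sum, Finset.sum_add_distrib, ← Finset.mul_sum, h2, h3]
  simp_rw [h4]
  rw [Finset.sum_sub_distrib, OrthonormalBasis.sum_sq_norm_inner_left]
  simp only [ContinuousLinearMap.comp_apply, innerSL_apply_apply, Real.norm_eq_abs, sq_abs,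
    real_inner_comm (σ x)]

end EnergyDensity

/-! ### The first variation formula. -/

section Differentiation

variable {E : Type*} [NormedAddCommGroup E] [InnerProductSpace ℝ E] [FiniteDimensional ℝ E]
  [MeasurableSpace E] [BorelSpace E]

/-- Differentiation under the integral sign over the unit sphere. -/
theorem hasDerivAt_integral_sphere {Φ : ℝ × E → ℝ}
    (hΦ : ∀ z : ℝ × E, z.2 ≠ 0 → ContDiffAt ℝ 1 Φ z) :
    HasDerivAt (fun t => ∫ x : Metric.sphere (0 : E) 1, Φ (t, x) ∂(volume : Measure E).toSphere)
      (∫ x : Metric.sphere (0 : E) 1, fderiv ℝ Φ (0, x) (1, 0) ∂(volume : Measure E).toSphere)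
      0 := by
  have hne : ∀ x : Metric.sphere (0 : E) 1, (x : E) ≠ 0 := ne_zero_of_mem_unit_sphere
  have hι : Continuous fun z : ℝ × Metric.sphere (0 : E) 1 => (z.1, (z.2 : E)) := by fun_prop
  have hc : Continuous fun z : ℝ × Metric.sphere (0 : E) 1 => Φ (z.1, z.2) := by
    rw [continuous_iff_continuousAt]
    intro z
    exact ContinuousAt.comp (f := fun z : ℝ × Metric.sphere (0 : E) 1 => (z.1, (z.2 : E)))
      (hΦ (z.1, z.2) (hne z.2)).continuousAt hι.continuousAt
  have hc' : Continuous fun z : ℝ × Metric.sphere (0 : E) 1 =>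
      fderiv ℝ Φ (z.1, z.2) (1, 0) := by
    rw [continuous_iff_continuousAt]
    intro z
    have h1 : ContinuousAt (fderiv ℝ Φ) (z.1, z.2) :=
      ((hΦ (z.1, z.2) (hne z.2)).fderiv_right (m := 0) (by simp)).continuousAt
    exact (ContinuousAt.comp (f := fun z : ℝ × Metric.sphere (0 : E) 1 => (z.1, (z.2 : E)))
      h1 hι.continuousAt).clm_apply continuousAt_const
  -- By compactness of `[-1, 1]` times the sphere, a constant dominates the time derivative.
  obtain ⟨C, hC⟩ := ((isCompact_Icc (a := (-1 : ℝ)) (b := 1)).prod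
    (isCompact_univ (X := Metric.sphere (0 : E) 1))).exists_bound_of_continuousOn hc'.continuousOn
  have hcx : ∀ t : ℝ, Continuous fun x : Metric.sphere (0 : E) 1 => Φ (t, x) := fun t =>
    hc.comp (continuous_const.prodMk continuous_id)
  refine (hasDerivAt_integral_of_dominated_loc_of_deriv_le
    (F := fun t (x : Metric.sphere (0 : E) 1) => Φ (t, x))
    (F' := fun t (x : Metric.sphere (0 : E) 1) => fderiv ℝ Φ (t, x) (1, 0))
    (s := Set.Icc (-1) 1) (bound := fun _ => C) (Icc_mem_nhds (by norm_num) (by norm_num))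
    (Filter.Eventually.of_forall fun t => (hcx t).aestronglyMeasurable)
    ((hcx 0).integrable_of_hasCompactSupport (HasCompactSupport.of_compactSpace _))
    (hc'.comp (continuous_const.prodMk continuous_id)).aestronglyMeasurable
    (Filter.Eventually.of_forall fun x t ht => hC (t, x) ⟨ht, Set.mem_univ _⟩)
    (integrable_const C) (Filter.Eventually.of_forall fun x t _ => ?_)).2
  have h1 : HasDerivAt (fun s : ℝ => (s, (x : E))) ((1 : ℝ), (0 : E)) t :=
    (hasDerivAt_id t).prodMk (hasDerivAt_const t _)
  exact ((hΦ (t, x) (hne x)).differentiableAt one_ne_zero).hasFDerivAt.comp_hasDerivAt t h1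

/-- The integrand of the first variation of the vertical energy at `σ` in the direction `V`. -/
def firstVariation (p q : ℝ) (σ V : Metric.sphere (0 : E) 1 → E)
    (x : Metric.sphere (0 : E) 1) : ℝ :=
  jetVariation p q (σ x) (V x)
    (fun a => fderiv ℝ (rayExt σ) (x : E) (stdOrthonormalBasis ℝ E a))
    (fun a => fderiv ℝ (rayExt V) (x : E) (stdOrthonormalBasis ℝ E a))

variable {n : ℕ} [Fact (finrank ℝ E = n + 1)] {τ : ℝ → Metric.sphere (0 : E) 1 → E}

/-- The first variation formula for the vertical energy. -/
theorem hasDerivAt_vertEnergy (p q : ℝ) {σ : Metric.sphere (0 : E) 1 → E}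
    (hτ : IsSmoothVariation n σ τ) {V : Metric.sphere (0 : E) 1 → E}
    (hV : ∀ x, HasDerivAt (fun t => τ t x) (V x) 0) :
    HasDerivAt (fun t => vertEnergy p q (τ t))
      (∫ x, firstVariation p q σ V x ∂(volume : Measure E).toSphere) 0 := by
  let D : Fin (finrank ℝ E) → ℝ × E → E := fun a z =>
    fderiv ℝ (fun z : ℝ × E => rayExt (τ z.1) z.2) z (0, stdOrthonormalBasis ℝ E a)
  have hD : ∀ (t : ℝ) (x : Metric.sphere (0 : E) 1), (fun a => D a (t, x)) =
      fun a => fderiv ℝ (rayExt (τ t)) x (stdOrthonormalBasis ℝ E a) := fun t x => by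
    rw [(hasFDerivAt_rayExt_family hτ.smooth t (ne_zero_of_mem_unit_sphere x)).fderiv]
    simp [D]
  let Φ : ℝ × E → ℝ := fun z => jetDensity p q (rayExt (τ z.1) z.2) (fun a => D a z)
  have hΦ : ∀ z : ℝ × E, z.2 ≠ 0 → ContDiffAt ℝ 1 Φ z := fun z hz =>
    contDiffAt_jetDensity p q ((contDiffAt_rayExt_family hτ.smooth hz).of_le
      (WithTop.coe_le_coe.2 le_top))
      fun a => (contDiffAt_fderiv_rayExt_family hτ.smooth hz).clm_apply contDiffAt_const
  have hdens : ∀ t (x : Metric.sphere (0 : E) 1), vertEnergyDensity p q (τ t) x = Φ (t, x) := by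
    intro t x
    rw [vertEnergyDensity_eq p q (hτ.tangent t) (hasFDerivAt_rayExt_family hτ.smooth t
      (ne_zero_of_mem_unit_sphere x)).differentiableAt]
    simp only [Φ, hD, rayExt_coe]
  have hder : ∀ x : Metric.sphere (0 : E) 1,
      fderiv ℝ Φ (0, x) (1, 0) = 2 * firstVariation p q σ V x := by
    intro x
    have hx0 : (x : E) ≠ 0 := ne_zero_of_mem_unit_sphere x
    have htime : HasDerivAt (fun t : ℝ => ((t, x) : ℝ × E)) (1, 0) 0 :=
      (hasDerivAt_id (0 : ℝ)).prodMk (hasDerivAt_const 0 _)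
    have h1 := ((hΦ (0, x) hx0).differentiableAt one_ne_zero).hasFDerivAt.comp_hasDerivAt 0 htime
    -- Both sides are the derivative of `t ↦ Φ (t, x)` at 0, once by the chain rule and once by the
    -- jet formula.
    refine h1.unique ?_
    have h2 := hasDerivAt_jetDensity p q (u := fun t => rayExt (τ t) x)
      (d := fun a t => D a (t, x)) (by simpa only [rayExt_coe] using hV x)
      (fun a => hasDerivAt_fderiv_rayExt_family hτ.smooth hV hx0 (stdOrthonormalBasis ℝ E a))
    rw [hD, hτ.init, rayExt_coe] at h2
    exact h2
  have hI := (hasDerivAt_integral_sphere hΦ).const_mul (1 / 2 : ℝ)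
  simp_rw [hder, integral_const_mul] at hI
  have hfun : (fun t => vertEnergy p q (τ t)) = fun t => 1 / 2 *
      ∫ x : Metric.sphere (0 : E) 1, Φ (t, x) ∂(volume : Measure E).toSphere := by
    funext t
    rw [vertEnergy]
    simp_rw [hdens]
  rw [hfun]
  refine hI.congr_deriv ?_
  ring

end Differentiation

/-! ### Harmonicity as a condition on variation fields. -/

section Sections

variable {E : Type*} [NormedAddCommGroup E] [InnerProductSpace ℝ E]

theorem contDiffAt_of_contDiffOn_compl {F : Type*} [NormedAddCommGroup F] [NormedSpace ℝ F]
    {h : E → F} (hh : ContDiffOn ℝ ∞ h {0}ᶜ) {y : E} (hy : y ≠ 0) : ContDiffAt ℝ ∞ h y :=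
  (hh y hy).contDiffAt (isOpen_compl_singleton.mem_nhds hy)

theorem differentiableAt_of_contDiffOn_compl {F : Type*} [NormedAddCommGroup F] [NormedSpace ℝ F]
    {h : E → F} (hh : ContDiffOn ℝ ∞ h {0}ᶜ) (x : Metric.sphere (0 : E) 1) :
    DifferentiableAt ℝ h (x : E) :=
  (contDiffAt_of_contDiffOn_compl hh (ne_zero_of_mem_unit_sphere x)).differentiableAt (by simp)

theorem continuous_sphere_of_contDiffOn {F : Type*} [NormedAddCommGroup F] [NormedSpace ℝ F]
    {h : E → F} (hh : ContDiffOn ℝ ∞ h {0}ᶜ) :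
    Continuous fun x : Metric.sphere (0 : E) 1 => h x :=
  hh.continuousOn.comp_continuous continuous_subtype_val fun x => ne_zero_of_mem_unit_sphere x

theorem contDiffOn_fderiv_compl {F : Type*} [NormedAddCommGroup F] [NormedSpace ℝ F]
    {h : E → F} (hh : ContDiffOn ℝ ∞ h {0}ᶜ) : ContDiffOn ℝ ∞ (fderiv ℝ h) {0}ᶜ :=
  hh.fderiv_of_isOpen isOpen_compl_singleton (by simp)

variable {n : ℕ} [Fact (finrank ℝ E = n + 1)]

theorem IsSmoothSection.contDiffOn {σ : Metric.sphere (0 : E) 1 → E} (hσ : IsSmoothSection n σ) :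
    ContDiffOn ℝ ∞ (rayExt σ) {0}ᶜ := contDiffOn_rayExt hσ.smooth

theorem IsSmoothSection.isSmoothVariation {σ V : Metric.sphere (0 : E) 1 → E}
    (hσ : IsSmoothSection n σ) (hV : IsSmoothSection n V) :
    IsSmoothVariation n σ fun t x => σ x + t • V x where
  smooth := (hσ.smooth.comp contMDiff_snd).add
    (contMDiff_fst.smul (hV.smooth.comp contMDiff_snd))
  tangent t x := Submodule.add_mem _ (hσ.tangent x) (Submodule.smul_mem _ _ (hV.tangent x))
  init := by funext x; simp

/-- The variation field of a smooth variation through vector fields is a smooth vector field. -/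
theorem IsSmoothVariation.exists_variationField {σ : Metric.sphere (0 : E) 1 → E}
    {τ : ℝ → Metric.sphere (0 : E) 1 → E} (hτ : IsSmoothVariation n σ τ) :
    ∃ V, IsSmoothSection n V ∧ ∀ x, HasDerivAt (fun t => τ t x) (V x) 0 := by
  let U : ℝ × E → E := fun z => rayExt (τ z.1) z.2
  have hV : ∀ x : Metric.sphere (0 : E) 1,
      HasDerivAt (fun t => τ t x) (fderiv ℝ U (0, x) (1, 0)) 0 := by
    intro x
    have htime : HasDerivAt (fun t : ℝ => ((t, x) : ℝ × E)) (1, 0) 0 :=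
      (hasDerivAt_id (0 : ℝ)).prodMk (hasDerivAt_const 0 _)
    have h1 := ((contDiffAt_rayExt_family hτ.smooth (z := (0, x))
      (ne_zero_of_mem_unit_sphere x)).differentiableAt (by simp)).hasFDerivAt.comp_hasDerivAt 0 htime
    have h2 : (fun t => τ t x) = U ∘ fun t : ℝ => (t, (x : E)) :=
      funext fun t => (rayExt_coe (τ t) x).symm
    rw [h2]
    exact h1
  refine ⟨fun x => fderiv ℝ U (0, x) (1, 0), ⟨?_, fun x => ?_⟩, hV⟩
  · refine contMDiff_restrict_sphere (h := fun y : E => fderiv ℝ U (0, y) (1, 0)) fun y hy => ?_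
    have h1 : ContDiffAt ℝ ∞ (fderiv ℝ U) (0, y) :=
      (contDiffAt_rayExt_family hτ.smooth (z := (0, y)) hy).fderiv_right (by simp)
    exact ((h1.comp y (contDiffAt_const.prodMk contDiffAt_id)).clm_apply
      contDiffAt_const).contDiffWithinAt
  · rw [mem_tangentPlane_iff]
    have h1 := (hasDerivAt_const (0 : ℝ) (x : E)).inner ℝ (hV x)
    have h2 : (fun t => ⟪(x : E), τ t x⟫_ℝ) = fun _ => 0 :=
      funext fun t => mem_tangentPlane_iff.1 (hτ.tangent t x)
    rw [h2] at h1
    simpa using h1.unique (hasDerivAt_const (0 : ℝ) (0 : ℝ))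

variable [FiniteDimensional ℝ E] [MeasurableSpace E] [BorelSpace E]

theorem integrable_sphere {g : Metric.sphere (0 : E) 1 → ℝ} (hg : Continuous g) :
    Integrable g (volume : Measure E).toSphere :=
  hg.integrable_of_hasCompactSupport (HasCompactSupport.of_compactSpace g)

/-- The derivative of the energy depends on a variation only through its initial velocity, which is
a smooth section; conversely every smooth section `V` is the velocity of `σ + t V`. -/
theorem isPQHarmonic_iff (p q : ℝ) {σ : Metric.sphere (0 : E) 1 → E} :
    IsPQHarmonic n p q σ ↔ IsSmoothSection n σ ∧ ∀ V, IsSmoothSection n V →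
      ∫ x, firstVariation p q σ V x ∂(volume : Measure E).toSphere = 0 := by
  refine and_congr_right fun hσ => ⟨fun h V hV => ?_, fun h τ hτ => ?_⟩
  · have hτ := hσ.isSmoothVariation hV
    refine (hasDerivAt_vertEnergy p q hτ fun x => ?_).unique (h _ hτ)
    simpa using ((hasDerivAt_id (0 : ℝ)).smul_const (V x)).const_add (σ x)
  · obtain ⟨V, hV, hd⟩ := hτ.exists_variationField
    exact (hasDerivAt_vertEnergy p q hτ hd).congr_deriv (h V hV)

end Sections

/-! ### Orthogonal complex structures and a twisted divergence identity. -/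

section ComplexStructure

variable {E : Type*} [NormedAddCommGroup E] [InnerProductSpace ℝ E]

/-- An orthogonal complex structure. -/
structure IsOrthogonalComplexStructure (J : E →L[ℝ] E) : Prop where
  inner_map_map : ∀ u v, ⟪J u, J v⟫_ℝ = ⟪u, v⟫_ℝ
  map_map : ∀ v, J (J v) = -v

namespace IsOrthogonalComplexStructure

variable {J : E →L[ℝ] E} (hJ : IsOrthogonalComplexStructure J)
include hJ

theorem inner_map_left (u v : E) : ⟪J u, v⟫_ℝ = -⟪u, J v⟫_ℝ := by
  rw [← hJ.inner_map_map u (J v), hJ.map_map, inner_neg_right, neg_neg]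

theorem inner_map_self (v : E) : ⟪J v, v⟫_ℝ = 0 := by
  have h := hJ.inner_map_left v v
  rw [real_inner_comm v (J v)] at h
  linarith [real_inner_comm v (J v)]

theorem inner_self_map (v : E) : ⟪v, J v⟫_ℝ = 0 := by
  rw [real_inner_comm]; exact hJ.inner_map_self v

theorem norm_map (v : E) : ‖J v‖ = ‖v‖ := by
  rw [norm_eq_sqrt_real_inner, hJ.inner_map_map, ← norm_eq_sqrt_real_inner]

end IsOrthogonalComplexStructure

theorem hasFDerivAt_norm_sphere (x : Metric.sphere (0 : E) 1) :
    HasFDerivAt (fun y : E => ‖y‖) (innerSL ℝ (x : E)) (x : E) := by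
  have hx1 : ‖(x : E)‖ = 1 := by simp
  have h1 := (hasStrictFDerivAt_norm_sq (x : E)).hasFDerivAt.sqrt (by rw [hx1]; norm_num)
  have h2 : (fun y : E => √(‖y‖ ^ 2)) = fun y => ‖y‖ := by
    funext y; exact Real.sqrt_sq (norm_nonneg y)
  rw [h2, hx1] at h1
  convert h1 using 1
  ext w
  simp

theorem rayExt_smul_map (J : E →L[ℝ] E) (f : Metric.sphere (0 : E) 1 → ℝ) {y : E} (hy : y ≠ 0) :
    rayExt (fun x => f x • J x) y = rayExt f y • ‖y‖⁻¹ • J y := by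
  simp only [rayExt, dif_neg hy, map_smul]

/-- The field `J x` extends to `‖y‖⁻¹ • J y`; differentiating the factor `‖y‖⁻¹` produces the
projection of `v` to the tangent plane. -/
theorem fderiv_rayExt_smul_map (J : E →L[ℝ] E) {f : Metric.sphere (0 : E) 1 → ℝ}
    {x : Metric.sphere (0 : E) 1} (hf : DifferentiableAt ℝ (rayExt f) (x : E)) (v : E) :
    fderiv ℝ (rayExt fun x => f x • J x) (x : E) v =
      fderiv ℝ (rayExt f) (x : E) v • J x + f x • J (v - ⟪(x : E), v⟫_ℝ • (x : E)) := by
  have hx0 : (x : E) ≠ 0 := ne_zero_of_mem_unit_sphere x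
  have hx1 : ‖(x : E)‖ = 1 := by simp
  have h1 : (rayExt fun x => f x • J x) =ᶠ[nhds (x : E)]
      fun y => rayExt f y • ‖y‖⁻¹ • J y := by
    filter_upwards [isOpen_compl_singleton.mem_nhds hx0] with y hy
    exact rayExt_smul_map J f hy
  have h2 : HasFDerivAt (fun y : E => ‖y‖⁻¹) (-innerSL ℝ (x : E)) (x : E) := by
    have h3 := (hasDerivAt_inv (x := ‖(x : E)‖) (by rw [hx1]; exact one_ne_zero)).comp_hasFDerivAt
      (x : E) (hasFDerivAt_norm_sphere x)
    rw [hx1] at h3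
    simpa [Function.comp_def] using h3
  have h3 := hf.hasFDerivAt.fun_smul (h2.fun_smul J.hasFDerivAt)
  rw [(h3.congr_of_eventuallyEq h1).fderiv]
  simp [rayExt_coe, hx1, smul_smul, smul_sub]
  abel_nf

theorem OrthonormalBasis.sum_inner_smul_map {ι F : Type*} [Fintype ι] [NormedAddCommGroup F]
    [NormedSpace ℝ F] (e : OrthonormalBasis ι ℝ E) (T : E →L[ℝ] F) (w : E) :
    ∑ a, ⟪w, e a⟫_ℝ • T (e a) = T w := by
  conv_rhs => rw [← e.sum_repr' w]
  simp [real_inner_comm]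

section Integrals

variable [FiniteDimensional ℝ E] [MeasurableSpace E] [BorelSpace E]
  {n : ℕ} [Fact (finrank ℝ E = n + 1)]

/-- Apply `integral_sphere_fderiv` to each function `⟪J e_a, Z⟫` along `e_a`; the sum of `⟪x, e_a⟫ J
e_a` collapses to `J x`. -/
theorem integral_sum_inner_map_fderiv (J : E →L[ℝ] E) {Z : E → E}
    (hZ : ContDiffOn ℝ ∞ Z {0}ᶜ) (hr : ∀ r : ℝ, 0 < r → ∀ y, Z (r • y) = Z y) :
    ∫ x : Metric.sphere (0 : E) 1, ∑ a, ⟪J (stdOrthonormalBasis ℝ E a),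
        fderiv ℝ Z x (stdOrthonormalBasis ℝ E a)⟫_ℝ ∂(volume : Measure E).toSphere =
      n * ∫ x : Metric.sphere (0 : E) 1, ⟪J x, Z x⟫_ℝ ∂(volume : Measure E).toSphere := by
  have hdim : finrank ℝ E = n + 1 := Fact.out
  have : Nontrivial E := Module.nontrivial_of_finrank_pos (R := ℝ) (by omega)
  set e := stdOrthonormalBasis ℝ E
  have hZc := continuous_sphere_of_contDiffOn hZ
  have hdZc := continuous_sphere_of_contDiffOn (contDiffOn_fderiv_compl hZ)
  have h1 : ∀ a, ∫ x : Metric.sphere (0 : E) 1, ⟪J (e a), fderiv ℝ Z x (e a)⟫_ℝ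
      ∂(volume : Measure E).toSphere = n * ∫ x : Metric.sphere (0 : E) 1,
        ⟪J (e a), Z x⟫_ℝ * ⟪(x : E), e a⟫_ℝ ∂(volume : Measure E).toSphere := by
    intro a
    have h2 := integral_sphere_fderiv (h := fun y => ⟪J (e a), Z y⟫_ℝ)
      (contDiffOn_const.inner ℝ hZ) (fun r hr0 y => by rw [hr r hr0]) (e a)
    rw [show finrank ℝ E - 1 = n by omega] at h2
    rw [← h2]
    congr 1
    funext x
    have h3 := (innerSL ℝ (J (e a))).hasFDerivAt.comp (x : E)
      (differentiableAt_of_contDiffOn_compl hZ x).hasFDerivAt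
    have h4 : (fun y => ⟪J (e a), Z y⟫_ℝ) = innerSL ℝ (J (e a)) ∘ Z := rfl
    rw [h4, h3.fderiv]
    rfl
  rw [integral_finsetSum _ fun a _ => integrable_sphere
    (continuous_const.inner (hdZc.clm_apply continuous_const))]
  simp_rw [h1]
  rw [← Finset.mul_sum, ← integral_finsetSum _ fun a _ => integrable_sphere
    ((continuous_const.inner hZc).fun_mul (continuous_subtype_val.inner continuous_const))]
  congr 2
  funext x
  have h5 := OrthonormalBasis.sum_inner_smul_map e ((innerSL ℝ (Z x)).comp J) (x : E)
  simp only [ContinuousLinearMap.comp_apply, innerSL_apply_apply, smul_eq_mul] at h5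
  rw [real_inner_comm, ← h5]
  refine Finset.sum_congr rfl fun a _ => ?_
  rw [real_inner_comm (Z x), mul_comm]

end Integrals

end ComplexStructure

/-! ### Pointwise first variation at multiples of the Hopf field. -/

section HopfVariation

variable {E : Type*} [NormedAddCommGroup E] [InnerProductSpace ℝ E]
  {n : ℕ} [Fact (finrank ℝ E = n + 1)] {J : E →L[ℝ] E}

namespace IsOrthogonalComplexStructure

variable (hJ : IsOrthogonalComplexStructure J)
include hJ

theorem isSmoothSection {f : Metric.sphere (0 : E) 1 → ℝ} (hf : ContMDiff (𝓡 n) 𝓘(ℝ, ℝ) ∞ f) :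
    IsSmoothSection n fun x => f x • J x where
  smooth := hf.smul (contMDiff_restrict_sphere J.contDiff.contDiffOn)
  tangent _ := Submodule.smul_mem _ _ (mem_tangentPlane_iff.2 (hJ.inner_self_map _))

theorem norm_sub_inner_smul (x : Metric.sphere (0 : E) 1) (v : E) :
    ‖J (v - ⟪(x : E), v⟫_ℝ • (x : E))‖ ^ 2 = ‖v‖ ^ 2 - ‖⟪(x : E), v⟫_ℝ‖ ^ 2 := by
  rw [hJ.norm_map, norm_sub_sq_real, norm_smul, norm_eq_of_mem_sphere x, inner_smul_right,
    real_inner_comm, Real.norm_eq_abs, mul_one, sq_abs]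
  ring

variable [FiniteDimensional ℝ E]

/-- The first variation at a constant multiple of the Hopf field. -/
theorem firstVariation_const (p q c : ℝ) {V : Metric.sphere (0 : E) 1 → E}
    (hV : IsSmoothSection n V) (x : Metric.sphere (0 : E) 1) :
    firstVariation p q (fun x => c • J x) V x =
      (1 + c ^ 2) ^ (-p) * c * ∑ a, ⟪J (stdOrthonormalBasis ℝ E a),
          fderiv ℝ (rayExt V) x (stdOrthonormalBasis ℝ E a)⟫_ℝ -
        ((1 + c ^ 2) ^ (-p) * c + p * (1 + c ^ 2) ^ (-p - 1) * c ^ 3 * (n - 1)) *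
          ⟪J x, V x⟫_ℝ := by
  have hdim : finrank ℝ E = n + 1 := Fact.out
  have hx : ‖(x : E)‖ = 1 := by simp
  set e := stdOrthonormalBasis ℝ E with he
  have hc : (rayExt fun _ : Metric.sphere (0 : E) 1 => c) =ᶠ[nhds (x : E)] fun _ => c := by
    filter_upwards [isOpen_compl_singleton.mem_nhds (ne_zero_of_mem_unit_sphere x)] with y hy
    exact dif_neg hy
  have hL : ∀ v, fderiv ℝ (rayExt fun x : Metric.sphere (0 : E) 1 => c • J x) (x : E) v =
      c • J (v - ⟪(x : E), v⟫_ℝ • (x : E)) := fun v => by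
    rw [fderiv_rayExt_smul_map J
      ((differentiableAt_const c).congr_of_eventuallyEq hc) v, hc.fderiv_eq]
    simp
  set M := fderiv ℝ (rayExt V) (x : E) with hMdef
  have hM : M x = 0 := fderiv_self_of_homogeneous (fun r hr y => rayExt_smul V hr y)
    (differentiableAt_of_contDiffOn_compl hV.contDiffOn x)
  have h1 : ‖c • J (x : E)‖ ^ 2 = c ^ 2 := by
    rw [norm_smul, hJ.norm_map, hx, mul_one, Real.norm_eq_abs, sq_abs]
  -- The derivatives of a constant multiple of the Hopf field are orthogonal to it, which removes
  -- every term with `q`.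
  have h2 : ∀ v, ⟪c • J (v - ⟪(x : E), v⟫_ℝ • (x : E)), c • J (x : E)⟫_ℝ = 0 := fun v => by
    rw [inner_smul_left, inner_smul_right, hJ.inner_map_map, inner_sub_left, inner_smul_left,
      real_inner_self_eq_norm_sq, hx, real_inner_comm]
    simp
  -- The squared norms of the projected basis vectors sum to `dim E - 1 = n`.
  have h3 : ∑ a, ‖c • J (e a - ⟪(x : E), e a⟫_ℝ • (x : E))‖ ^ 2 = c ^ 2 * n := by
    simp_rw [norm_smul, mul_pow, hJ.norm_sub_inner_smul]
    rw [← Finset.mul_sum, Finset.sum_sub_distrib, e.sum_sq_norm_inner_left, hx]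
    simp [hdim]
  have h4 : ∑ a, ⟪c • J (e a - ⟪(x : E), e a⟫_ℝ • (x : E)), M (e a)⟫_ℝ =
      c * ∑ a, ⟪J (e a), M (e a)⟫_ℝ := by
    have h5 := OrthonormalBasis.sum_inner_smul_map e ((innerSL ℝ (J x)).comp M) (x : E)
    simp only [ContinuousLinearMap.comp_apply, innerSL_apply_apply, smul_eq_mul, hM,
      inner_zero_right] at h5
    simp_rw [inner_smul_left, map_sub, map_smul, inner_sub_left, inner_smul_left]
    rw [← Finset.mul_sum, Finset.sum_sub_distrib]
    simp [h5]
  simp only [firstVariation, jetVariation, hL, ← he, ← hMdef]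
  simp only [h1, h2, h3, h4, zero_mul, Finset.sum_const_zero]
  simp only [inner_smul_left, conj_trivial, zero_pow two_ne_zero, Finset.sum_const_zero]
  ring

/-- The first variation at a multiple of the Hopf field in a direction orthogonal to the
Hopf field. -/
theorem firstVariation_of_orthogonal (p q : ℝ) {f : Metric.sphere (0 : E) 1 → ℝ}
    (hf : ContMDiff (𝓡 n) 𝓘(ℝ, ℝ) ∞ f) {V : Metric.sphere (0 : E) 1 → E}
    (hV : IsSmoothSection n V) (hVJ : ∀ x, ⟪V x, J x⟫_ℝ = 0) (x : Metric.sphere (0 : E) 1) :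
    firstVariation p q (fun x => f x • J x) V x =
      (1 + f x ^ 2) ^ (-p) * (fderiv ℝ (rayExt f) x (J (V x)) +
        f x * ∑ a, ⟪J (stdOrthonormalBasis ℝ E a),
          fderiv ℝ (rayExt V) x (stdOrthonormalBasis ℝ E a)⟫_ℝ) := by
  have hx : ‖(x : E)‖ = 1 := by simp
  set e := stdOrthonormalBasis ℝ E with he
  have hL := fderiv_rayExt_smul_map J
    (differentiableAt_of_contDiffOn_compl (contDiffOn_rayExt hf) x)
  set T := fderiv ℝ (rayExt f) (x : E)
  have hVd := differentiableAt_of_contDiffOn_compl hV.contDiffOn x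
  have hM : fderiv ℝ (rayExt V) (x : E) x = 0 :=
    fderiv_self_of_homogeneous (fun r hr y => rayExt_smul V hr y) hVd
  -- Obtained by differentiating `⟪V, J y⟫ = 0`.
  have hMJ : ∀ v, ⟪J x, fderiv ℝ (rayExt V) (x : E) v⟫_ℝ = -⟪V x, J v⟫_ℝ := by
    intro v
    have h1 := hVd.hasFDerivAt.inner ℝ (J.hasFDerivAt (x := (x : E)))
    have h2 : (fun y => ⟪rayExt V y, J y⟫_ℝ) = fun _ => 0 := by
      funext y
      by_cases hy : y = 0
      · simp [hy]
      · have h3 := hVJ ⟨‖y‖⁻¹ • y, by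
          rw [mem_sphere_zero_iff_norm, norm_smul, norm_inv, norm_norm,
            inv_mul_cancel₀ (norm_ne_zero_iff.mpr hy)]⟩
        rw [map_smul, inner_smul_right] at h3
        rw [rayExt, dif_neg hy]
        rcases mul_eq_zero.1 h3 with h4 | h4
        · simp [hy] at h4
        · exact h4
    rw [h2] at h1
    have h3 := congrArg (fun S : E →L[ℝ] ℝ => S v) (h1.unique (hasFDerivAt_const (0 : ℝ) (x : E)))
    simp [rayExt_coe] at h3
    rw [real_inner_comm]
    linarith
  set M := fderiv ℝ (rayExt V) (x : E) with hMdef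
  have h1 : ‖f x • J (x : E)‖ ^ 2 = f x ^ 2 := by
    rw [norm_smul, hJ.norm_map, hx, mul_one, Real.norm_eq_abs, sq_abs]
  have hJV : ⟪J (x : E), V x⟫_ℝ = 0 := by rw [real_inner_comm]; exact hVJ x
  -- This is the derivative of `⟪σ, V⟫ = 0`; it is a factor of each `q`-term. The `p`-term vanishes
  -- because `⟪σ, V⟫` does.
  have h2 : ∀ v, ⟪M v, f x • J (x : E)⟫_ℝ +
      ⟪T v • J (x : E) + f x • J (v - ⟪(x : E), v⟫_ℝ • (x : E)), V x⟫_ℝ = 0 := fun v => by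
    simp only [inner_smul_right, inner_add_left, inner_smul_left, map_sub, map_smul,
      inner_sub_left, hJV, conj_trivial]
    rw [real_inner_comm, hMJ, real_inner_comm (V x)]
    ring
  have h4 : ∑ a, ⟪T (e a) • J (x : E) + f x • J (e a - ⟪(x : E), e a⟫_ℝ • (x : E)), M (e a)⟫_ℝ =
      T (J (V x)) + f x * ∑ a, ⟪J (e a), M (e a)⟫_ℝ := by
    have h5 := OrthonormalBasis.sum_inner_smul_map e ((innerSL ℝ (J x)).comp M) (x : E)
    have h6 := OrthonormalBasis.sum_inner_smul_map e T (J (V x))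
    simp only [ContinuousLinearMap.comp_apply, innerSL_apply_apply, smul_eq_mul, hM,
      inner_zero_right] at h5
    rw [← h6, Finset.mul_sum, ← Finset.sum_add_distrib, ← sub_eq_zero, ← Finset.sum_sub_distrib,
      ← neg_eq_zero, ← mul_zero (f x), ← h5, Finset.mul_sum, ← Finset.sum_neg_distrib]
    refine Finset.sum_congr rfl fun a _ => ?_
    simp only [inner_add_left, inner_smul_left, map_sub, map_smul,
      inner_sub_left, conj_trivial, hMJ, hJ.inner_map_left (V x), smul_eq_mul]
    ring
  simp only [firstVariation, jetVariation, hL, ← he, ← hMdef]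
  simp only [h1, h2, h4, inner_smul_left, hJV]
  simp

end IsOrthogonalComplexStructure

end HopfVariation

/-! ### The integrated first variation and its consequence for `f`. -/

section HopfIntegrals

variable {E : Type*} [NormedAddCommGroup E] [InnerProductSpace ℝ E]
  {n : ℕ} [Fact (finrank ℝ E = n + 1)] {J : E →L[ℝ] E}

theorem one_add_sq_rpow_neg (c p : ℝ) :
    (1 + c ^ 2) ^ (-p) = (1 + c ^ 2) ^ (-p - 1) * (1 + c ^ 2) := by
  rw [← Real.rpow_add_one (by positivity), sub_add_cancel]

namespace IsOrthogonalComplexStructure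

variable (hJ : IsOrthogonalComplexStructure J)
include hJ

variable [FiniteDimensional ℝ E] [MeasurableSpace E] [BorelSpace E]

/-- The divergence identity turns the sum into `n ⟪Jx, V⟫`; combined with the term `-⟪Jx, V⟫` it
gives the same factor `n - 1` as the `p`-term. -/
theorem integral_firstVariation_const (p q c : ℝ) {V : Metric.sphere (0 : E) 1 → E}
    (hV : IsSmoothSection n V) :
    ∫ x, firstVariation p q (fun x => c • J x) V x ∂(volume : Measure E).toSphere =
      (1 + c ^ 2) ^ (-p - 1) * (c * (n - 1) * (1 + c ^ 2 - p * c ^ 2)) *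
        ∫ x : Metric.sphere (0 : E) 1, ⟪J x, V x⟫_ℝ ∂(volume : Measure E).toSphere := by
  have hVc := continuous_sphere_of_contDiffOn hV.contDiffOn
  have hdVc := continuous_sphere_of_contDiffOn (contDiffOn_fderiv_compl hV.contDiffOn)
  have hJc : Continuous fun x : Metric.sphere (0 : E) 1 => J x :=
    J.continuous.comp continuous_subtype_val
  simp_rw [hJ.firstVariation_const p q c hV]
  have h1 := integral_sum_inner_map_fderiv (n := n) J hV.contDiffOn
    (fun r hr y => rayExt_smul V hr y)
  simp_rw [rayExt_coe] at h1 hVc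
  rw [integral_sub ((integrable_sphere (continuous_finsetSum _ fun a _ =>
    continuous_const.inner (hdVc.clm_apply continuous_const))).const_mul _)
    ((integrable_sphere (hJc.inner hVc)).const_mul _), integral_const_mul, integral_const_mul, h1,
    one_add_sq_rpow_neg c p]
  ring

/-- The divergence identity for `u V`, with `u = (1 + f²)^(-p) f`, has zero right side since `V` is
orthogonal to `Jx`. It trades the term with derivatives of `V` for `du(JV)`, which adds to `(1 +
f²)^(-p) df(JV)`. -/
theorem integral_firstVariation_of_orthogonal (p q : ℝ) {f : Metric.sphere (0 : E) 1 → ℝ}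
    (hf : ContMDiff (𝓡 n) 𝓘(ℝ, ℝ) ∞ f) {V : Metric.sphere (0 : E) 1 → E}
    (hV : IsSmoothSection n V) (hVJ : ∀ x, ⟪V x, J x⟫_ℝ = 0) :
    ∫ x, firstVariation p q (fun x => f x • J x) V x ∂(volume : Measure E).toSphere =
      ∫ x : Metric.sphere (0 : E) 1, 2 * (1 + f x ^ 2) ^ (-p - 1) * (1 + (1 - p) * f x ^ 2) *
        fderiv ℝ (rayExt f) x (J (V x)) ∂(volume : Measure E).toSphere := by
  set F := rayExt f with hF
  have hFs : ContDiffOn ℝ ∞ F {0}ᶜ := contDiffOn_rayExt hf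
  have hpos : ∀ y, 1 + F y ^ 2 ≠ 0 := fun y => by positivity
  let u : E → ℝ := fun y => (1 + F y ^ 2) ^ (-p) * F y
  have hu : ContDiffOn ℝ ∞ u {0}ᶜ :=
    ((contDiffOn_const.add (hFs.pow 2)).rpow_const_of_ne fun y _ => hpos y).mul hFs
  have hdu : ∀ (x : Metric.sphere (0 : E) 1) (v : E), fderiv ℝ u x v =
      (1 + f x ^ 2) ^ (-p - 1) * (1 + f x ^ 2 - 2 * p * f x ^ 2) * fderiv ℝ F x v := by
    intro x v
    have h1 := (differentiableAt_of_contDiffOn_compl hFs x).hasFDerivAt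
    have h2 := (((h1.pow 2).const_add 1).rpow_const (p := -p) (Or.inl (hpos x))).fun_mul h1
    rw [h2.fderiv]
    have h3 : F x = f x := rayExt_coe f x
    simp [h3, one_add_sq_rpow_neg (f x) p]
    ring
  have hZ : ContDiffOn ℝ ∞ (fun y => u y • rayExt V y) {0}ᶜ := hu.smul hV.contDiffOn
  have hint := integral_sum_inner_map_fderiv (n := n) J hZ
    (fun r hr y => by simp only [u, hF, rayExt_smul _ hr])
  have hJc : Continuous fun x : Metric.sphere (0 : E) 1 => J x :=
    J.continuous.comp continuous_subtype_val
  have h0 : ∀ x : Metric.sphere (0 : E) 1, ⟪J x, u x • rayExt V x⟫_ℝ = 0 := fun x => by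
    rw [inner_smul_right, rayExt_coe, real_inner_comm, hVJ, mul_zero]
  simp_rw [h0] at hint
  rw [integral_zero, mul_zero] at hint
  have hVc : Continuous V := by
    simpa only [rayExt_coe] using continuous_sphere_of_contDiffOn hV.contDiffOn
  have hfc : Continuous f := hf.continuous
  have hdFc := continuous_sphere_of_contDiffOn (contDiffOn_fderiv_compl hFs)
  have hdZc := continuous_sphere_of_contDiffOn (contDiffOn_fderiv_compl hZ)
  have hint2 : Integrable (fun x : Metric.sphere (0 : E) 1 =>
      2 * (1 + f x ^ 2) ^ (-p - 1) * (1 + (1 - p) * f x ^ 2) * fderiv ℝ F x (J (V x)))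
      (volume : Measure E).toSphere := by
    refine integrable_sphere (((continuous_const.mul ((continuous_const.add
      (hfc.pow 2)).rpow_const fun x => Or.inl ?_)).mul
      (continuous_const.add (continuous_const.mul (hfc.pow 2)))).mul
      (hdFc.clm_apply (J.continuous.comp hVc)))
    show (1 + f x ^ 2 : ℝ) ≠ 0
    positivity
  symm
  rw [← zero_add (∫ _, _ ∂_), ← hint, ← integral_add (integrable_sphere
    (continuous_finsetSum _ fun a _ => continuous_const.inner
      (hdZc.clm_apply continuous_const))) hint2]
  congr 1
  funext x
  rw [hJ.firstVariation_of_orthogonal p q hf hV hVJ x]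
  have h1 := (differentiableAt_of_contDiffOn_compl hu x).hasFDerivAt.fun_smul
    (differentiableAt_of_contDiffOn_compl hV.contDiffOn x).hasFDerivAt
  have h2 : ∀ v, fderiv ℝ (fun y => u y • rayExt V y) (x : E) v =
      u x • fderiv ℝ (rayExt V) (x : E) v + fderiv ℝ u (x : E) v • V x := fun v => by
    rw [h1.fderiv]
    simp [rayExt_coe]
  have h3 := OrthonormalBasis.sum_inner_smul_map (stdOrthonormalBasis ℝ E)
    (fderiv ℝ u (x : E)) (J (V x))
  have h4 : ∑ a, ⟪J (stdOrthonormalBasis ℝ E a),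
      fderiv ℝ (fun y => u y • rayExt V y) (x : E) (stdOrthonormalBasis ℝ E a)⟫_ℝ =
      u x * ∑ a, ⟪J (stdOrthonormalBasis ℝ E a),
        fderiv ℝ (rayExt V) (x : E) (stdOrthonormalBasis ℝ E a)⟫_ℝ -
        fderiv ℝ u (x : E) (J (V x)) := by
    rw [← h3, Finset.mul_sum, ← Finset.sum_sub_distrib]
    refine Finset.sum_congr rfl fun a _ => ?_
    rw [h2, inner_add_right, inner_smul_right, inner_smul_right, hJ.inner_map_left _ (V x),
      real_inner_comm (J (V x)), smul_eq_mul, real_inner_comm]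
    simp only [real_inner_comm]
    ring
  rw [h4, hdu]
  have h5 : u x = (1 + f x ^ 2) ^ (-p) * f x := by simp only [u, hF, rayExt_coe]
  rw [h5, one_add_sq_rpow_neg (f x) p]
  ring

/-- If `f ξ` is harmonic, then `f` is stationary in the directions orthogonal to `ξ`, except where
`1 + (1 - p) f² = 0`. -/
theorem mul_fderiv_eq_zero_of_isPQHarmonic {p q : ℝ} {f : Metric.sphere (0 : E) 1 → ℝ}
    (hf : ContMDiff (𝓡 n) 𝓘(ℝ, ℝ) ∞ f) (h : IsPQHarmonic n p q fun x => f x • J x)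
    (x : Metric.sphere (0 : E) 1) {v : E} (hv : ⟪J x, v⟫_ℝ = 0) :
    (1 + (1 - p) * f x ^ 2) * fderiv ℝ (rayExt f) x v = 0 := by
  have := FiniteDimensional.complete ℝ E
  set F := rayExt f with hF
  have hFs : ContDiffOn ℝ ∞ F {0}ᶜ := contDiffOn_rayExt hf
  let G : E → E := fun y => (InnerProductSpace.toDual ℝ E).symm (fderiv ℝ F y)
  have hGin : ∀ y v, ⟪G y, v⟫_ℝ = fderiv ℝ F y v := fun y v =>
    InnerProductSpace.toDual_symm_apply
  have hG : ContDiffOn ℝ ∞ G {0}ᶜ :=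
    (InnerProductSpace.toDual ℝ E).symm.contDiff.comp_contDiffOn (contDiffOn_fderiv_compl hFs)
  -- On the sphere, `H` is the component of the gradient orthogonal to both `x` and `J x`.
  let H : E → E := fun y => G y - ⟪G y, J y⟫_ℝ • J y
  have hH : ContDiffOn ℝ ∞ H {0}ᶜ :=
    hG.sub ((hG.inner ℝ J.contDiff.contDiffOn).smul J.contDiff.contDiffOn)
  let k : E → ℝ := fun y => 1 + (1 - p) * F y ^ 2
  have hk : ContDiffOn ℝ ∞ k {0}ᶜ := contDiffOn_const.add (contDiffOn_const.mul (hFs.pow 2))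
  -- Chosen so that `J W = k H`; then `df(J W) = k ‖H‖²` and the integrand contains `‖k H‖²`.
  -- Multiplying by `k` compensates for its possible change of sign.
  let W : E → E := fun y => -(k y • J (H y))
  have hW : ContDiffOn ℝ ∞ W {0}ᶜ := (hk.smul (J.contDiff.comp_contDiffOn hH)).neg
  have hGx : ∀ x : Metric.sphere (0 : E) 1, ⟪G x, (x : E)⟫_ℝ = 0 := fun x => by
    rw [hGin]
    exact fderiv_self_of_homogeneous (fun r hr y => rayExt_smul f hr y)
      (differentiableAt_of_contDiffOn_compl hFs x)
  have hJx : ∀ x : Metric.sphere (0 : E) 1, ⟪J (x : E), J x⟫_ℝ = 1 := fun x => by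
    rw [hJ.inner_map_map, real_inner_self_eq_norm_sq, norm_eq_of_mem_sphere, one_pow]
  have hHJ : ∀ x : Metric.sphere (0 : E) 1, ⟪H x, J x⟫_ℝ = 0 := fun x => by
    simp only [H, inner_sub_left, inner_smul_left, hJx]
    simp
  have hHx : ∀ x : Metric.sphere (0 : E) 1, ⟪H x, (x : E)⟫_ℝ = 0 := fun x => by
    simp [H, inner_sub_left, inner_smul_left, hGx, hJ.inner_map_self]
  have hV : IsSmoothSection n fun x => W x := by
    refine ⟨contMDiff_restrict_sphere hW, fun x => ?_⟩
    rw [mem_tangentPlane_iff, real_inner_comm]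
    simp [W, inner_neg_left, inner_smul_left, hJ.inner_map_left, hHJ]
  have hVJ : ∀ x : Metric.sphere (0 : E) 1, ⟪W x, J x⟫_ℝ = 0 := fun x => by
    simp [W, inner_neg_left, inner_smul_left, hJ.inner_map_map, hHx]
  have hJV : ∀ x : Metric.sphere (0 : E) 1, J (W x) = k x • H x := fun x => by
    simp [W, hJ.map_map]
  have hnorm : ∀ x : Metric.sphere (0 : E) 1, fderiv ℝ F x (H x) = ‖H x‖ ^ 2 := fun x => by
    rw [← hGin, ← real_inner_self_eq_norm_sq]
    conv_rhs => rw [show ⟪H x, H x⟫_ℝ = ⟪G x - ⟪G x, J x⟫_ℝ • J x, H x⟫_ℝ from rfl]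
    rw [inner_sub_left, inner_smul_left, real_inner_comm (H x) (J x), hHJ, mul_zero, sub_zero]
  have h1 := ((isPQHarmonic_iff p q).1 h).2 _ hV
  rw [hJ.integral_firstVariation_of_orthogonal p q hf hV hVJ] at h1
  have hkx : ∀ x : Metric.sphere (0 : E) 1, k x = 1 + (1 - p) * f x ^ 2 := fun x => by
    simp only [k, hF, rayExt_coe]
  have h2 : ∀ x : Metric.sphere (0 : E) 1,
      2 * (1 + f x ^ 2) ^ (-p - 1) * (1 + (1 - p) * f x ^ 2) * fderiv ℝ (rayExt f) x (J (W x)) =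
      2 * (1 + f x ^ 2) ^ (-p - 1) * ‖k x • H x‖ ^ 2 := fun x => by
    rw [hJV, map_smul, hnorm, norm_smul, mul_pow, Real.norm_eq_abs, sq_abs, smul_eq_mul, ← hkx]
    ring
  simp_rw [h2] at h1
  have hpos : ∀ x, 0 < (1 + f x ^ 2) ^ (-p - 1) := fun x => by positivity
  have hc : Continuous fun x : Metric.sphere (0 : E) 1 =>
      2 * (1 + f x ^ 2) ^ (-p - 1) * ‖k x • H x‖ ^ 2 := by
    refine (continuous_const.mul ((continuous_const.add
      (hf.continuous.pow 2)).rpow_const fun x => Or.inl ?_)).mul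
      ((continuous_sphere_of_contDiffOn (hk.smul hH)).norm.pow 2)
    show (1 + f x ^ 2 : ℝ) ≠ 0
    positivity
  have h3 := (hc.ae_eq_iff_eq (volume : Measure E).toSphere continuous_const).1
    ((integral_eq_zero_iff_of_nonneg (fun x => by have := hpos x; positivity)
      (integrable_sphere hc)).1 h1)
  have h4 : 2 * (1 + f x ^ 2) ^ (-p - 1) * ‖k x • H x‖ ^ 2 = 0 := congrFun h3 x
  have h5 : k x • H x = 0 := by
    have := (hpos x).ne'
    simpa [this] using h4
  have h6 : fderiv ℝ F x v = ⟪H x, v⟫_ℝ := by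
    rw [← hGin]
    simp [H, inner_sub_left, inner_smul_left, hv]
  rw [h6, ← hkx, ← real_inner_smul_left, h5, inner_zero_left]

end IsOrthogonalComplexStructure

end HopfIntegrals

/-! ### Horizontal connectivity of the sphere and constancy of `f`. -/

section Constancy

theorem subsingleton_of_finite_of_isPreconnected {s : Set ℝ} (hs : s.Finite)
    (hc : IsPreconnected s) : s.Subsingleton := by
  by_contra h
  rw [Set.not_subsingleton_iff] at h
  obtain ⟨a, ha, b, hb, hab⟩ := h.exists_lt
  exact (Set.Icc_infinite hab) (hs.subset (hc.Icc_subset ha hb))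

variable {E : Type*} [NormedAddCommGroup E] [InnerProductSpace ℝ E] {J : E →L[ℝ] E}

theorem exists_unit_orthogonal [FiniteDimensional ℝ E] (hdim : 2 < finrank ℝ E)
    (J : E →L[ℝ] E) (y : E) :
    ∃ z : E, ‖z‖ = 1 ∧ ⟪z, y⟫_ℝ = 0 ∧ ⟪z, J y⟫_ℝ = 0 := by
  classical
  let K : Submodule ℝ E := Submodule.span ℝ (({y, J y} : Finset E) : Set E)
  have hK : finrank ℝ K ≤ 2 :=
    (finrank_span_finset_le_card _).trans Finset.card_le_two
  have hne : Kᗮ ≠ ⊥ := by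
    intro h
    rw [Submodule.orthogonal_eq_bot_iff] at h
    rw [h, finrank_top] at hK
    omega
  obtain ⟨w, hw, hw0⟩ := Submodule.exists_mem_ne_zero_of_ne_bot hne
  have hin : ∀ v ∈ ({y, J y} : Finset E), ⟪w, v⟫_ℝ = 0 := fun v hv =>
    Submodule.inner_left_of_mem_orthogonal (Submodule.subset_span hv) hw
  refine ⟨‖w‖⁻¹ • w, ?_, ?_, ?_⟩
  · rw [norm_smul, norm_inv, norm_norm, inv_mul_cancel₀ (norm_ne_zero_iff.2 hw0)]
  · rw [real_inner_smul_left, hin y (by simp), mul_zero]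
  · rw [real_inner_smul_left, hin (J y) (by simp), mul_zero]

namespace IsOrthogonalComplexStructure

variable (hJ : IsOrthogonalComplexStructure J)
include hJ

/-- A function on the sphere that is stationary in the directions orthogonal to `J x` takes the
same values at the endpoints of the projection to the sphere of a horizontal segment. -/
theorem eq_of_horizontal {F : E → ℝ} (hF : ContDiffOn ℝ ∞ F {0}ᶜ)
    (hr : ∀ r : ℝ, 0 < r → ∀ y, F (r • y) = F y)
    (h0 : ∀ (x : Metric.sphere (0 : E) 1) (v : E), ⟪J x, v⟫_ℝ = 0 → fderiv ℝ F x v = 0)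
    {x y : E} (hx : ‖x‖ = 1) (hy : ‖y‖ = 1) (hxy : ⟪J x, y⟫_ℝ = 0) (hnn : 0 ≤ ⟪x, y⟫_ℝ) :
    F x = F y := by
  let γ : ℝ → E := fun s => x + s • (y - x)
  have hγ : ∀ s, HasDerivAt γ (y - x) s := fun s => by
    simpa [γ] using ((hasDerivAt_id s).smul_const (y - x)).const_add x
  have hne : ∀ s ∈ Set.Icc (0 : ℝ) 1, γ s ≠ 0 := by
    intro s hs h
    -- With `⟪x, y⟫ ≥ 0` this is at least `(1 - s)² + s² > 0`, so the segment avoids the origin.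
    have h1 : ‖γ s‖ ^ 2 = (1 - s) ^ 2 + s ^ 2 + 2 * (s * (1 - s)) * ⟪x, y⟫_ℝ := by
      have h2 : γ s = (1 - s) • x + s • y := by simp only [γ]; module
      rw [h2, norm_add_sq_real, norm_smul, norm_smul, hx, hy, inner_smul_left, inner_smul_right]
      simp
      ring
    rw [h] at h1
    have h3 : 0 ≤ s * (1 - s) * ⟪x, y⟫_ℝ :=
      mul_nonneg (mul_nonneg hs.1 (by linarith [hs.2])) hnn
    simp at h1
    nlinarith [sq_nonneg (1 - 2 * s)]
  have hd : ∀ s ∈ Set.Icc (0 : ℝ) 1, HasDerivAt (F ∘ γ) 0 s := by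
    intro s hs
    have hdF : ∀ z : E, z ≠ 0 → DifferentiableAt ℝ F z := fun z hz =>
      (contDiffAt_of_contDiffOn_compl hF hz).differentiableAt (by simp)
    refine ((hdF _ (hne s hs)).hasFDerivAt.comp_hasDerivAt s (hγ s)).congr_deriv ?_
    have hpos : 0 < ‖γ s‖ := norm_pos_iff.2 (hne s hs)
    have hu : ‖γ s‖⁻¹ • γ s ∈ Metric.sphere (0 : E) 1 := by
      rw [mem_sphere_zero_iff_norm, norm_smul, norm_inv, norm_norm, inv_mul_cancel₀ hpos.ne']
    -- The velocity `y - x` is orthogonal to `J (γ s)` all along the segment; homogeneity moves the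
    -- derivative from `γ s` to its unit multiple.
    have h1 := h0 ⟨_, hu⟩ (y - x) (by
      have h2 : ⟪J y, x⟫_ℝ = 0 := by
        rw [hJ.inner_map_left, real_inner_comm, hxy, neg_zero]
      simp [γ, inner_smul_left, inner_sub_right, inner_add_left, hxy, h2,
        inner_sub_left, hJ.inner_map_self])
    rw [fderiv_smul_of_homogeneous hr (inv_pos.2 hpos) (hdF _ (ne_zero_of_mem_unit_sphere ⟨_, hu⟩)),
      smul_eq_mul] at h1
    rcases mul_eq_zero.1 h1 with h1 | h1
    · simp [hpos.ne'] at h1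
    · exact h1
  have h1 := constant_of_has_deriv_right_zero (f := F ∘ γ) (a := 0) (b := 1)
    (fun s hs => (hd s hs).continuousAt.continuousWithinAt)
    (fun s hs => (hd s ⟨hs.1, hs.2.le⟩).hasDerivWithinAt) 1 ⟨zero_le_one, le_rfl⟩
  simp only [Function.comp, γ, one_smul, zero_smul, add_zero, add_sub_cancel] at h1
  exact h1.symm

/-- The hyperplane field orthogonal to the Hopf field is nonintegrable: a function that is
stationary along it is constant. -/
theorem eq_of_fderiv_horizontal_eq_zero [FiniteDimensional ℝ E] (hdim : 2 < finrank ℝ E)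
    {F : E → ℝ} (hF : ContDiffOn ℝ ∞ F {0}ᶜ) (hr : ∀ r : ℝ, 0 < r → ∀ y, F (r • y) = F y)
    (h0 : ∀ (x : Metric.sphere (0 : E) 1) (v : E), ⟪J x, v⟫_ℝ = 0 → fderiv ℝ F x v = 0)
    {x y : E} (hx : ‖x‖ = 1) (hy : ‖y‖ = 1) : F x = F y := by
  obtain ⟨z, hz, hzy, hzJ⟩ := exists_unit_orthogonal hdim J y
  -- These are the coordinates of a point `w = a y + b J y` on the Hopf circle of `y` with `⟪J x, w⟫
  -- = 0` and `⟪x, w⟫ ≥ 0`. Horizontal arcs then join `x` to `w`, `w` to `z` and `z` to `y`, as `z`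
  -- is orthogonal to the whole circle.
  have hrot : ∃ a b : ℝ, a ^ 2 + b ^ 2 = 1 ∧ a * ⟪J x, y⟫_ℝ + b * ⟪x, y⟫_ℝ = 0 ∧
      0 ≤ a * ⟪x, y⟫_ℝ - b * ⟪J x, y⟫_ℝ := by
    set α := ⟪J x, y⟫_ℝ
    set β := ⟪x, y⟫_ℝ
    by_cases h : α ^ 2 + β ^ 2 = 0
    · refine ⟨1, 0, by norm_num, ?_, ?_⟩
      · nlinarith [sq_nonneg α, sq_nonneg β]
      · nlinarith [sq_nonneg α, sq_nonneg β]
    · have hpos : 0 < α ^ 2 + β ^ 2 := lt_of_le_of_ne (by positivity) (Ne.symm h)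
      have hsq := Real.sq_sqrt hpos.le
      have hr0 : 0 < √(α ^ 2 + β ^ 2) := Real.sqrt_pos.2 hpos
      set r := √(α ^ 2 + β ^ 2)
      refine ⟨β / r, -α / r, ?_, ?_, ?_⟩
      · field_simp
        linarith
      · field_simp
        ring
      · have : β / r * β - -α / r * α = (α ^ 2 + β ^ 2) / r := by
          field_simp
          ring
        rw [this]
        positivity
  obtain ⟨a, b, hab, h1, h2⟩ := hrot
  have hxJ : ⟪x, J y⟫_ℝ = -⟪J x, y⟫_ℝ := by rw [hJ.inner_map_left, neg_neg]
  set w := a • y + b • J y with hw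
  have hwn : ‖w‖ = 1 := by
    have h3 : ‖w‖ ^ 2 = 1 := by
      rw [hw, norm_add_sq_real, norm_smul, norm_smul, hJ.norm_map, hy, inner_smul_left,
        inner_smul_right, hJ.inner_self_map]
      simp [hab]
    exact (pow_eq_one_iff_of_nonneg (norm_nonneg w) two_ne_zero).1 h3
  have e1 : F x = F w := hJ.eq_of_horizontal hF hr h0 hx hwn
    (by rw [hw, inner_add_right, inner_smul_right, inner_smul_right, hJ.inner_map_map]; exact h1)
    (by
      rw [hw, inner_add_right, inner_smul_right, inner_smul_right, hxJ]
      linarith)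
  have e2 : F z = F w := hJ.eq_of_horizontal hF hr h0 hz hwn
    (by
      rw [hw, inner_add_right, inner_smul_right, inner_smul_right, hJ.inner_map_map, hzy,
        hJ.inner_map_left, hzJ]
      simp)
    (by rw [hw, inner_add_right, inner_smul_right, inner_smul_right, hzy, hzJ]; simp)
  have e3 : F z = F y := hJ.eq_of_horizontal hF hr h0 hz hy
    (by rw [hJ.inner_map_left, hzJ, neg_zero]) hzy.ge
  rw [e1, ← e2, e3]

variable {n : ℕ} [Fact (finrank ℝ E = n + 1)] [FiniteDimensional ℝ E]

theorem exists_eq_const_of_mul_fderiv_eq_zero (hn : 2 ≤ n) {k : ℝ}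
    {f : Metric.sphere (0 : E) 1 → ℝ} (hf : ContMDiff (𝓡 n) 𝓘(ℝ, ℝ) ∞ f)
    (h : ∀ (x : Metric.sphere (0 : E) 1) (v : E), ⟪J x, v⟫_ℝ = 0 →
      (1 + k * f x ^ 2) * fderiv ℝ (rayExt f) x v = 0) : ∃ c, ∀ x, f x = c := by
  have hdim : finrank ℝ E = n + 1 := Fact.out
  have hfs : ContDiffOn ℝ ∞ (rayExt f) {0}ᶜ := contDiffOn_rayExt hf
  -- A primitive in `f`: `dG = (1 + k f²) df`, so the hypothesis says that `G` is horizontally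
  -- stationary, with no division by a factor that may vanish.
  let G : E → ℝ := fun y => rayExt f y + k / 3 * rayExt f y ^ 3
  have hG : ContDiffOn ℝ ∞ G {0}ᶜ := hfs.add (contDiffOn_const.mul (hfs.pow 3))
  have hGd : ∀ (x : Metric.sphere (0 : E) 1) (v : E), ⟪J x, v⟫_ℝ = 0 → fderiv ℝ G x v = 0 := by
    intro x v hv
    have h1 := (differentiableAt_of_contDiffOn_compl hfs x).hasFDerivAt
    have h2 := h1.fun_add ((h1.pow 3).const_mul (k / 3))
    rw [h2.fderiv, ← h x v hv]
    simp [rayExt_coe]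
    ring
  have hconst : ∀ x y : Metric.sphere (0 : E) 1, G x = G y := fun x y =>
    hJ.eq_of_fderiv_horizontal_eq_zero (by omega) hG
      (fun r hr0 y => by simp only [G, rayExt_smul f hr0]) hGd
      (norm_eq_of_mem_sphere x) (norm_eq_of_mem_sphere y)
  have hrank : 1 < Module.rank ℝ E := by
    rw [← finrank_eq_rank, hdim]
    exact_mod_cast (by omega : 1 < n + 1)
  have hconn := isConnected_sphere hrank (0 : E) (zero_le_one (α := ℝ))
  obtain ⟨x₀, hx₀⟩ := hconn.nonempty
  have : PreconnectedSpace (Metric.sphere (0 : E) 1) :=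
    Subtype.preconnectedSpace hconn.isPreconnected
  have hpre : IsPreconnected (Set.range f) := isPreconnected_range hf.continuous
  have hfin : (Set.range f).Finite := by
    -- Every value of `f` is a root of `P`, which is nonzero whatever `k` is, because its linear
    -- coefficient is 1.
    let P : Polynomial ℝ := Polynomial.X + Polynomial.C (k / 3) * Polynomial.X ^ 3 -
      Polynomial.C (G x₀)
    have hP : P ≠ 0 := by
      intro h0
      have h1 : P.coeff 1 = 1 := by
        simp [P, Polynomial.coeff_X_pow]
      rw [h0] at h1
      simp at h1
    refine (P.rootSet_finite ℝ).subset ?_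
    rintro _ ⟨x, rfl⟩
    rw [Polynomial.mem_rootSet]
    refine ⟨hP, ?_⟩
    have h1 := hconst x ⟨x₀, hx₀⟩
    simp only [G, rayExt_coe] at h1
    simp [P, G, h1]
  have hsub := subsingleton_of_finite_of_isPreconnected hfin hpre
  exact ⟨f ⟨x₀, hx₀⟩, fun x => hsub ⟨x, rfl⟩ ⟨_, rfl⟩⟩

variable [MeasurableSpace E] [BorelSpace E]

/-- Directions orthogonal to the Hopf field force `f` to be constant; the Hopf direction then fixes
the constant. The bound `2 ≤ n` supplies both a third orthogonal direction and `n - 1 ≠ 0`. -/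
theorem isPQHarmonic_smul_iff (hn : 2 ≤ n) (p q : ℝ) {f : Metric.sphere (0 : E) 1 → ℝ}
    (hf : ContMDiff (𝓡 n) 𝓘(ℝ, ℝ) ∞ f) :
    IsPQHarmonic n p q (fun x => f x • J x) ↔
      ∃ c, (∀ x, f x = c) ∧ c * (1 + c ^ 2 - p * c ^ 2) = 0 := by
  have hdim : finrank ℝ E = n + 1 := Fact.out
  have : Nontrivial E := Module.nontrivial_of_finrank_pos (R := ℝ) (by omega)
  constructor
  · intro h
    obtain ⟨c, hc⟩ := hJ.exists_eq_const_of_mul_fderiv_eq_zero hn hf fun x v hv =>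
      hJ.mul_fderiv_eq_zero_of_isPQHarmonic hf h x hv
    refine ⟨c, hc, ?_⟩
    simp_rw [hc] at h
    -- Testing with the Hopf field itself, the remaining integral is the total measure of the
    -- sphere, which is nonzero.
    have hV : IsSmoothSection n fun x : Metric.sphere (0 : E) 1 => J x := by
      simpa using hJ.isSmoothSection (n := n)
        (contMDiff_const (c := (1 : ℝ)) : ContMDiff (𝓡 n) 𝓘(ℝ, ℝ) ∞ fun _ => (1 : ℝ))
    have h1 := ((isPQHarmonic_iff p q).1 h).2 _ hV
    rw [hJ.integral_firstVariation_const p q c hV] at h1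
    simp only [hJ.inner_map_map, real_inner_self_eq_norm_sq, norm_eq_of_mem_sphere, one_pow,
      integral_const, smul_eq_mul, mul_one] at h1
    have h2 : (volume : Measure E).toSphere.real Set.univ ≠ 0 := by
      rw [measureReal_def, ENNReal.toReal_ne_zero]
      exact ⟨mt Measure.measure_univ_eq_zero.1 (Measure.toSphere_ne_zero _), measure_ne_top _ _⟩
    have h3 : (1 + c ^ 2) ^ (-p - 1) ≠ 0 := by positivity
    have h4 : (n : ℝ) - 1 ≠ 0 := by
      have : (2 : ℝ) ≤ n := by exact_mod_cast hn
      linarith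
    simp only [mul_eq_zero, h2, h3, h4, or_false, false_or] at h1
    exact mul_eq_zero.2 h1
  · rintro ⟨c, hc, h0⟩
    rw [isPQHarmonic_iff]
    refine ⟨hJ.isSmoothSection hf, fun V hV => ?_⟩
    simp_rw [hc]
    rw [hJ.integral_firstVariation_const p q c hV, mul_right_comm c, h0]
    simp

end IsOrthogonalComplexStructure

end Constancy

/-! ### Multiplication by `i`, the critical constants and the conclusion. -/

section Hopf

/-- Multiplication by `i` on `ℂ^{m+1}` as a real linear map. -/
def mulI (m : ℕ) : EuclideanSpace ℂ (Fin (m + 1)) →L[ℝ] EuclideanSpace ℂ (Fin (m + 1)) :=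
  (Complex.I • ContinuousLinearMap.id ℂ (EuclideanSpace ℂ (Fin (m + 1)))).restrictScalars ℝ

theorem mulI_apply (m : ℕ) (v : EuclideanSpace ℂ (Fin (m + 1))) : mulI m v = Complex.I • v := rfl

theorem isOrthogonalComplexStructure_mulI (m : ℕ) :
    IsOrthogonalComplexStructure (mulI m) where
  inner_map_map u v := by
    simp only [mulI_apply, PiLp.inner_apply, PiLp.smul_apply, Complex.inner, smul_eq_mul, map_mul,
      Complex.conj_I]
    refine Finset.sum_congr rfl fun i _ => ?_
    congr 1
    linear_combination (-(starRingEnd ℂ (u i)) * v i) * Complex.I_sq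
  map_map v := by
    rw [mulI_apply, mulI_apply, smul_smul, Complex.I_mul_I, neg_one_smul]

end Hopf

/-- The nonzero critical values. -/
theorem ne_zero_and_mul_eq_zero_iff (p c : ℝ) :
    (c * (1 + c ^ 2 - p * c ^ 2) = 0 ∧ c ≠ 0) ↔
      1 < p ∧ (c = 1 / √(p - 1) ∨ c = -(1 / √(p - 1))) := by
  constructor
  · rintro ⟨h, hc⟩
    have h1 : c ^ 2 * (p - 1) = 1 := by
      rcases mul_eq_zero.1 h with h | h
      · exact absurd h hc
      · linarith
    have hc2 : 0 < c ^ 2 := by positivity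
    have hp : 0 < p - 1 := by
      by_contra hneg
      nlinarith
    refine ⟨by linarith, sq_eq_sq_iff_eq_or_eq_neg.1 ?_⟩
    rw [div_pow, one_pow, Real.sq_sqrt hp.le]
    field_simp
    linarith
  · rintro ⟨hp, h⟩
    have hp' : 0 < p - 1 := by linarith
    have hs : 0 < √(p - 1) := Real.sqrt_pos.2 hp'
    have h1 : c ^ 2 * (p - 1) = 1 := by
      rw [sq_eq_sq_iff_eq_or_eq_neg.2 h, div_pow, one_pow, Real.sq_sqrt hp'.le]
      field_simp
    refine ⟨by linear_combination -c * h1, ?_⟩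
    rintro rfl
    simp at h1

end HopfPQ

end

open HopfPQ in
theorem theorem5p4 (m : ℕ) (hm : 1 ≤ m) (p q : ℝ)
    (f : Metric.sphere (0 : EuclideanSpace ℂ (Fin (m + 1))) 1 → ℝ)
    (hf : ContMDiff (𝓡 (2 * m + 1)) 𝓘(ℝ, ℝ) ∞ f) :
    (IsPQHarmonic (2 * m + 1) p q (fun x => f x • hopf m x) ∧
        (fun x => f x • hopf m x) ≠ 0) ↔
      1 < p ∧ ((∀ x, f x = 1 / √(p - 1)) ∨ (∀ x, f x = -(1 / √(p - 1)))) := by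
  have hiff := (isOrthogonalComplexStructure_mulI m).isPQHarmonic_smul_iff (n := 2 * m + 1)
    (by omega) p q hf
  have hne : Nonempty (Metric.sphere (0 : EuclideanSpace ℂ (Fin (m + 1))) 1) :=
    (NormedSpace.sphere_nonempty.2 zero_le_one).to_subtype
  obtain ⟨x₀⟩ := hne
  have hh : ∀ x, hopf m x ≠ 0 := fun x =>
    smul_ne_zero Complex.I_ne_zero (ne_zero_of_mem_unit_sphere x)
  constructor
  · rintro ⟨h, h0⟩
    obtain ⟨c, hc, hcrit⟩ := hiff.1 h
    have hc0 : c ≠ 0 := by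
      rintro rfl
      exact h0 (funext fun x => by simp [hc])
    obtain ⟨hp, h1⟩ := (ne_zero_and_mul_eq_zero_iff p c).1 ⟨hcrit, hc0⟩
    exact ⟨hp, h1.imp (fun h1 x => (hc x).trans h1) fun h1 x => (hc x).trans h1⟩
  · rintro ⟨hp, h⟩
    obtain ⟨c, hc, h1⟩ : ∃ c, (∀ x, f x = c) ∧ (c = 1 / √(p - 1) ∨ c = -(1 / √(p - 1))) := by
      rcases h with h | h
      · exact ⟨_, h, Or.inl rfl⟩
      · exact ⟨_, h, Or.inr rfl⟩
    obtain ⟨hcrit, hc0⟩ := (ne_zero_and_mul_eq_zero_iff p c).2 ⟨hp, h1⟩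
    refine ⟨hiff.2 ⟨c, hc, hcrit⟩, fun h0 => ?_⟩
    have h2 := congrFun h0 x₀
    simp only [hc, Pi.zero_apply] at h2
    exact smul_ne_zero hc0 (hh x₀) h2
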